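/- **Conventions.** Let $\mathcal B\subseteq\mathscr B(G)$ be a von Neumann algebra on a Hilbert space $G$. A *von Neumann $\mathcal B$-$\mathcal B$-module* is a Hilbert $\mathcal B$-module $E$ which is strongly closed in $\mathscr B(G,E\odot G)$, with a unital left action of $\mathcal B$ by adjointable operators for which the induced representation of $\mathcal B$ on $E\odot G$ is normal; tensor products $\odot$ of such modules are strong closures. An *inclusion system* $(E,\beta)$ is a family $(E_t)_{t\ge 0}$ of von Neumann $\mathcal B$-$\mathcal B$-modules with $E_0=\mathcal B$ and adjointable bilinear isometries $\beta_{s,t}:E_{s+t}\to E_s\odot E_t$ with $(\beta_{r,s}\odot\mathrm{id})\beta_{r+s,t}=(\mathrm{id}\odot\beta_{s,t})\beta_{r,s+t}$. For maps $\varphi_t:\mathcal B\to\mathcal B$, an inclusion system $(E,\beta)$ together with vectors $\xi_t\in E_t$ is *associated to* $(\varphi_t)_{t\ge0}$ if $\varphi_t(a)=\langle\xi_t,a\xi_t\rangle$ for all $a\in\mathcal B$, $E_t=\overline{\operatorname{span}}^{s}\,\mathcal B\xi_t\mathcal B$, $\beta_{s,t}\xi_{s+t}=\xi_s\odot\xi_t$,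 and $\xi_0=1$. A *(weak) morphism* $T:(E,\beta)\to(F,\gamma)$ is a family of adjointable bilinear maps $T_t:E_t\to F_t$ with $\|T_t\|\le e^{tk}$ for some $k\in\mathbb R$ and $T_{s+t}=\gamma_{s,t}^*(T_s\odot T_t)\beta_{s,t}$; it is *contractive* if $\|T_t\|\le1$ for all $t$. The same notions are used for the von Neumann algebra $M_2(\mathcal B)$ on $G\oplus G$. Let $\mathbb E_{ij}$ be the matrix units of $M_2(\mathcal B)$. For a right $M_2(\mathcal B)$-module $F$, let $F^{(\mathcal B)}$ be the quotient of $F$ by the kernel of the semi-inner product $\langle x,y\rangle_\Sigma=\sum_{i,j}\langle x,y\rangle_{ij}$, a $\mathcal B$-module under $[x]b=[x\,\mathrm{diag}(b,b)]$, and write $[x]$ for the class of $x$. **Theorem.** Let $(\Phi_t)_{t\ge0}$ be normal completely positive maps on $M_2(\mathcal B)$ with $\Phi_0=\mathrm{id}$, $\Phi_{s+t}=\Phi_s\circ\Phi_t$, of the block form $$\Phi_t\begin{pmatrix}a&b\\c&d\end{pmatrix}=\begin{pmatrix}\varphi^1_t(a)&\psi_t(b)\\ \psi_t(c^*)^*&\varphi^2_t(d)\end{pmatrix}.$$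 Then there is an inclusion system associated to $\Phi$. For every inclusion system $(E,\beta,\eta)$ associated to $\Phi$, put, for $i=1,2$ and $t\ge0$, $\eta^i_t=\mathbb E_{ii}\eta_t\mathbb E_{ii}$ and $\xi^i_t=[\eta^i_t]\in(\mathbb E_{ii}E_t)^{(\mathcal B)}$, where $a\in\mathcal B$ acts from the left as $\mathrm{diag}(a,a)$, and let $E^i_t=\overline{\operatorname{span}}^{s}\,\mathcal B\xi^i_t\mathcal B\subseteq(\mathbb E_{ii}E_t)^{(\mathcal B)}$. Then: 1. $\beta_{s,t}\eta^i_{s+t}=\eta^i_s\odot\eta^i_t$ for all $s,t\ge0$ and $i=1,2$; 2. there are maps $\beta^i_{s,t}:E^i_{s+t}\to E^i_s\odot E^i_t$ such that $(E^i,\beta^i,\xi^i)$ is an inclusion system associated to $\varphi^i=(\varphi^i_t)_{t\ge0}$, $i=1,2$; 3. there is exactly one contractive (weak) morphism $T=(T_t):(E^2,\beta^2)\to(E^1,\beta^1)$ such that $\psi_t(a)=\langle\xi^1_t,T_t\,a\,\xi^2_t\rangle$ for all $a\in\mathcal B$ and $t\ge0$. -/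

import Mathlib

open ContinuousLinearMap
open scoped InnerProductSpace NNReal

universe u

noncomputable section

namespace VNMod

section Algebra

variable {G : Type u} [NormedAddCommGroup G] [InnerProductSpace ℂ G] [CompleteSpace G]

instance instSMulMemVN : SMulMemClass (VonNeumannAlgebra G) ℂ (G →L[ℂ] G) :=
  ⟨fun {S} c _ hx => S.toStarSubalgebra.smul_mem hx c⟩

instance instIsClosedVN (B : VonNeumannAlgebra G) : IsClosed (B : Set (G →L[ℂ] G)) := by
  rw [← VonNeumannAlgebra.centralizer_centralizer]
  exact Set.isClosed_centralizer _

instance instStarOrderedRingVN (B : VonNeumannAlgebra G) : StarOrderedRing B := by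
  refine StarOrderedRing.of_nonneg_iff' (fun {x y} h z => ?_) (fun x => ?_)
  · exact add_le_add_right (α := G →L[ℂ] G) h _
  · constructor
    · intro h
      have h' : (0 : G →L[ℂ] G) ≤ x := h
      refine ⟨⟨CFC.sqrt (x : G →L[ℂ] G), ?_⟩, Subtype.ext ?_⟩
      · rw [CFC.sqrt_eq_real_sqrt _ h']
        exact cfcₙ_mem _ x.2
      · change (x : G →L[ℂ] G) = star (CFC.sqrt (x : G →L[ℂ] G)) * CFC.sqrt (x : G →L[ℂ] G)
        rw [(CFC.sqrt_nonneg (x : G →L[ℂ] G)).isSelfAdjoint.star_eq, CFC.sqrt_mul_sqrt_self _ h']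
    · rintro ⟨s, rfl⟩
      exact star_mul_self_nonneg (s : G →L[ℂ] G)

/-- Membership in a von Neumann algebra is tested against the commutant. -/
lemma mem_of_comm (B : VonNeumannAlgebra G) {x : G →L[ℂ] G}
    (h : ∀ c : G →L[ℂ] G, (∀ b ∈ B, b * c = c * b) → c * x = x * c) : x ∈ B := by
  rw [← VonNeumannAlgebra.commutant_commutant B, VonNeumannAlgebra.mem_commutant_iff]
  exact fun c hc => h c (VonNeumannAlgebra.mem_commutant_iff.mp hc)

variable (G) in
/-- The Hilbert space `G ⊕ G`. -/
abbrev Sq := PiLp 2 (fun _ : Fin 2 => G)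

variable (G) in
/-- The `i`-th coordinate projection `G ⊕ G → G`. -/
abbrev prj (i : Fin 2) : Sq G →L[ℂ] G := PiLp.proj 2 (fun _ : Fin 2 => G) i

variable (G) in
/-- The `i`-th coordinate inclusion `G → G ⊕ G`. -/
def inj (i : Fin 2) : G →L[ℂ] Sq G := adjoint (prj G i)

lemma inj_apply (i : Fin 2) (g : G) : inj G i g = PiLp.single 2 i g := by
  refine ext_inner_right ℂ fun v => ?_
  rw [inj, adjoint_inner_left, PiLp.inner_apply, Finset.sum_eq_single i]
  · simp
  · intro j _ hj
    simp [hj]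
  · simp

lemma prj_comp_inj (i j : Fin 2) :
    prj G i ∘L inj G j = if i = j then ContinuousLinearMap.id ℂ G else 0 := by
  ext g
  by_cases h : i = j
  · subst h; simp [inj_apply]
  · simp [inj_apply, h]

lemma sum_inj_comp_prj :
    inj G 0 ∘L prj G 0 + inj G 1 ∘L prj G 1 = ContinuousLinearMap.id ℂ (Sq G) := by
  ext v i
  fin_cases i <;> simp [inj_apply]

/-- The `(i, j)` entry of an operator on `G ⊕ G`. -/
def entry (i j : Fin 2) (X : Sq G →L[ℂ] Sq G) : G →L[ℂ] G := prj G i ∘L X ∘L inj G j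

lemma entry_add (i j : Fin 2) (X Y : Sq G →L[ℂ] Sq G) :
    entry i j (X + Y) = entry i j X + entry i j Y := by
  ext g; simp [entry]

lemma entry_smul (i j : Fin 2) (c : ℂ) (X : Sq G →L[ℂ] Sq G) :
    entry i j (c • X) = c • entry i j X := by
  ext g; simp [entry]

lemma entry_mul (i j : Fin 2) (X Y : Sq G →L[ℂ] Sq G) :
    entry i j (X * Y) = entry i 0 X * entry 0 j Y + entry i 1 X * entry 1 j Y := by
  ext g
  have h := congrArg (fun Z => prj G i (X (Z (Y (inj G j g))))) (sum_inj_comp_prj (G := G))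
  simpa [entry] using h.symm

lemma entry_star (i j : Fin 2) (X : Sq G →L[ℂ] Sq G) :
    entry i j (star X) = star (entry j i X) := by
  simp [entry, inj, star_eq_adjoint, adjoint_comp, comp_assoc]

lemma entry_one (i j : Fin 2) : entry i j (1 : Sq G →L[ℂ] Sq G) = if i = j then 1 else 0 :=
  prj_comp_inj i j

lemma ext_entry {X Y : Sq G →L[ℂ] Sq G} (h : ∀ i j, entry i j X = entry i j Y) : X = Y := by
  have key : ∀ Z : Sq G →L[ℂ] Sq G, Z = ∑ i, ∑ j, inj G i ∘L entry i j Z ∘L prj G j := by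
    intro Z
    ext v i
    have hv := congrArg (fun W => Z (W v)) (sum_inj_comp_prj (G := G))
    simp only [add_apply, comp_apply, id_apply, map_add] at hv
    conv_lhs => rw [← hv]
    fin_cases i <;> simp [entry, inj_apply]
  rw [key X, key Y]
  simp [h]

/-- The von Neumann algebra `M₂(B)` on `G ⊕ G`: all operators on `G ⊕ G` whose four entries
belong to `B`. -/
def M2 (B : VonNeumannAlgebra G) : VonNeumannAlgebra (Sq G) where
  carrier := {X | ∀ i j, entry i j X ∈ B}
  mul_mem' {X Y} hX hY i j := by
    rw [entry_mul]
    exact add_mem (mul_mem (hX _ _) (hY _ _)) (mul_mem (hX _ _) (hY _ _))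
  add_mem' {X Y} hX hY i j := by
    rw [entry_add]
    exact add_mem (hX i j) (hY i j)
  algebraMap_mem' c i j := by
    rw [Algebra.algebraMap_eq_smul_one, entry_smul, entry_one]
    exact SMulMemClass.smul_mem _ (by split_ifs; exacts [one_mem B, zero_mem B])
  star_mem' {X} hX i j := by
    rw [entry_star]
    exact star_mem (hX j i)
  centralizer_centralizer' := by
    refine Set.Subset.antisymm (fun X hX i j => ?_) Set.subset_centralizer_centralizer
    refine mem_of_comm B fun c hc => ?_
    -- the diagonal operator with both diagonal entries equal to `c`
    set D : Sq G →L[ℂ] Sq G := inj G 0 ∘L c ∘L prj G 0 + inj G 1 ∘L c ∘L prj G 1 with hD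
    have hDe : ∀ i j, entry i j D = if i = j then c else 0 := by
      intro i j
      ext g
      fin_cases i <;> fin_cases j <;> simp [hD, entry, inj_apply]
    have hDX : D * X = X * D := by
      refine (hX D fun Y hY => ext_entry fun i j => ?_).symm ▸ rfl
      rw [entry_mul, entry_mul]
      simp only [hDe]
      fin_cases i <;> fin_cases j <;> simp [hc _ (hY _ _)]
    have h := congrArg (entry i j) hDX
    rw [entry_mul, entry_mul] at h
    simp only [hDe] at h
    fin_cases i <;> fin_cases j <;> simpa using h

lemma mem_M2 {B : VonNeumannAlgebra G} {X : Sq G →L[ℂ] Sq G} :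
    X ∈ M2 B ↔ ∀ i j, entry i j X ∈ B := Iff.rfl

/-- The element of `M₂(B)` with the prescribed matrix entries. -/
def M2.of {B : VonNeumannAlgebra G} (m : Matrix (Fin 2) (Fin 2) B) : M2 B :=
  ⟨∑ i, ∑ j, inj G i ∘L (m i j : G →L[ℂ] G) ∘L prj G j, by
    intro i j
    have : entry i j (∑ i, ∑ j, inj G i ∘L (m i j : G →L[ℂ] G) ∘L prj G j) = m i j := by
      ext g
      fin_cases i <;> fin_cases j <;> simp [entry, inj_apply]
    rw [this]
    exact (m i j).2⟩

namespace M2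

variable {B : VonNeumannAlgebra G}

/-- The `(i, j)` entry of an element of `M₂(B)`, as an element of `B`. -/
def ent (i j : Fin 2) (X : M2 B) : B := ⟨entry i j (X : Sq G →L[ℂ] Sq G), X.2 i j⟩

lemma ext_ent {X Y : M2 B} (h : ∀ i j, ent i j X = ent i j Y) : X = Y :=
  Subtype.ext <| ext_entry fun i j => congrArg Subtype.val (h i j)

lemma ent_of (m : Matrix (Fin 2) (Fin 2) B) (i j : Fin 2) : ent i j (M2.of m) = m i j := by
  refine Subtype.ext ?_
  ext g
  fin_cases i <;> fin_cases j <;> simp [ent, M2.of, entry, inj_apply]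

lemma ent_mul (i j : Fin 2) (X Y : M2 B) :
    ent i j (X * Y) = ent i 0 X * ent 0 j Y + ent i 1 X * ent 1 j Y :=
  Subtype.ext (entry_mul i j (X : Sq G →L[ℂ] Sq G) Y)

lemma ent_add (i j : Fin 2) (X Y : M2 B) : ent i j (X + Y) = ent i j X + ent i j Y :=
  Subtype.ext (entry_add i j (X : Sq G →L[ℂ] Sq G) Y)

lemma ent_smul (i j : Fin 2) (c : ℂ) (X : M2 B) : ent i j (c • X) = c • ent i j X :=
  Subtype.ext (entry_smul i j c (X : Sq G →L[ℂ] Sq G))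

lemma ent_star (i j : Fin 2) (X : M2 B) : ent i j (star X) = star (ent j i X) :=
  Subtype.ext (entry_star i j (X : Sq G →L[ℂ] Sq G))

lemma ent_one (i j : Fin 2) : ent i j (1 : M2 B) = if i = j then 1 else 0 := by
  refine Subtype.ext ((entry_one i j).trans ?_)
  split_ifs <;> rfl

variable (B) in
/-- The matrix unit `𝔼ᵢⱼ` of `M₂(B)`. -/
def unit (i j : Fin 2) : M2 B := M2.of (Matrix.single i j 1)

variable (B) in
/-- The unital embedding `a ↦ diag(a, a)` of `B` into `M₂(B)`. -/
def diag : B →⋆ₐ[ℂ] M2 B where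
  toFun a := M2.of (Matrix.diagonal fun _ => a)
  map_one' := ext_ent fun i j => by rw [ent_of, ent_one, Matrix.diagonal_apply]
  map_mul' a b := ext_ent fun i j => by
    simp only [ent_mul, ent_of]
    fin_cases i <;> fin_cases j <;> simp
  map_zero' := ext_ent fun i j => by
    have h : ent i j (0 : M2 B) = 0 := by simpa using ent_smul i j 0 (0 : M2 B)
    rw [ent_of, h]
    simp
  map_add' a b := ext_ent fun i j => by
    simp only [ent_add, ent_of]
    fin_cases i <;> fin_cases j <;> simp
  commutes' c := ext_ent fun i j => by
    rw [ent_of, Algebra.algebraMap_eq_smul_one, Algebra.algebraMap_eq_smul_one, ent_smul, ent_one,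
      Matrix.diagonal_apply]
    split_ifs <;> simp
  map_star' a := ext_ent fun i j => by
    simp only [ent_star, ent_of]
    fin_cases i <;> fin_cases j <;> simp

lemma diag_mul_unit (a : B) (i j : Fin 2) :
    diag B a * unit B i j = unit B i j * diag B a := ext_ent fun k l => by
  change ent k l (M2.of _ * M2.of _) = ent k l (M2.of _ * M2.of _)
  simp only [ent_mul, ent_of]
  fin_cases i <;> fin_cases j <;> fin_cases k <;> fin_cases l <;> simp [Matrix.single]

lemma unit_mul_self (i : Fin 2) : unit B i i * unit B i i = unit B i i := ext_ent fun k l => by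
  simp only [unit, ent_mul, ent_of]
  fin_cases i <;> fin_cases k <;> fin_cases l <;> simp [Matrix.single]

end M2

end Algebra

section SOT

variable {G H G' H' : Type*} [NormedAddCommGroup G] [InnerProductSpace ℂ G]
  [NormedAddCommGroup H] [InnerProductSpace ℂ H] [NormedAddCommGroup G'] [InnerProductSpace ℂ G']
  [NormedAddCommGroup H'] [InnerProductSpace ℂ H']

/-- A bounded operator regarded as a plain function. -/
def coeFunₗ : (G →L[ℂ] H) →ₗ[ℂ] (G → H) where
  toFun x := x
  map_add' _ _ := rfl
  map_smul' _ _ := rfl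

/-- The closure of a subspace of `𝓑(G, H)` in the strong operator topology, that is, in the topology
of pointwise convergence. -/
def sotClosure (S : Submodule ℂ (G →L[ℂ] H)) : Submodule ℂ (G →L[ℂ] H) :=
  ((S.map coeFunₗ).topologicalClosure).comap coeFunₗ

lemma mem_sotClosure {S : Submodule ℂ (G →L[ℂ] H)} {x : G →L[ℂ] H} :
    x ∈ sotClosure S ↔ (x : G → H) ∈ closure ((fun y : G →L[ℂ] H => (y : G → H)) '' S) :=
  Iff.rfl

lemma le_sotClosure (S : Submodule ℂ (G →L[ℂ] H)) : S ≤ sotClosure S := fun x hx =>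
  mem_sotClosure.mpr (subset_closure ⟨x, hx, rfl⟩)

lemma sotClosure_map {S : Submodule ℂ (G →L[ℂ] H)} {S' : Submodule ℂ (G' →L[ℂ] H')}
    (L : H →L[ℂ] H') (R : G' →L[ℂ] G) (h : ∀ y ∈ S, L ∘L y ∘L R ∈ S') {x : G →L[ℂ] H}
    (hx : x ∈ sotClosure S) : L ∘L x ∘L R ∈ sotClosure S' := by
  have hc : Continuous fun f : G → H => fun g : G' => L (f (R g)) :=
    continuous_pi fun g => L.continuous.comp (continuous_apply (R g))
  have := map_mem_closure (t := (fun y : G' →L[ℂ] H' => (y : G' → H')) '' S') hc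
    (mem_sotClosure.mp hx) (by rintro _ ⟨y, hy, rfl⟩; exact ⟨_, h y hy, rfl⟩)
  exact mem_sotClosure.mpr this

lemma sotClosure_induction {S : Submodule ℂ (G →L[ℂ] H)} (p : (G → H) → Prop)
    (hp : IsClosed {f | p f}) (h : ∀ y ∈ S, p y) {x : G →L[ℂ] H} (hx : x ∈ sotClosure S) : p x := by
  refine closure_minimal ?_ hp (mem_sotClosure.mp hx)
  rintro _ ⟨y, hy, rfl⟩
  exact h y hy

lemma sotClosure_mono {S S' : Submodule ℂ (G →L[ℂ] H)} (h : S ≤ S') :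
    sotClosure S ≤ sotClosure S' := fun _ hx =>
  closure_mono (Set.image_mono h) (mem_sotClosure.mp hx)

lemma sotClosure_idem (S : Submodule ℂ (G →L[ℂ] H)) :
    sotClosure (sotClosure S) ≤ sotClosure S := fun _ hx =>
  sotClosure_induction (fun f => f ∈ closure ((fun y : G →L[ℂ] H => (y : G → H)) '' S))
    isClosed_closure (fun _ hy => mem_sotClosure.mp hy) hx

lemma sotClosure_inner_mem [CompleteSpace G] [CompleteSpace H] (B : VonNeumannAlgebra G)
    {S S' : Submodule ℂ (G →L[ℂ] H)} (h : ∀ x ∈ S, ∀ y ∈ S', adjoint x ∘L y ∈ B)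
    {x y : G →L[ℂ] H} (hx : x ∈ sotClosure S) (hy : y ∈ sotClosure S') :
    adjoint x ∘L y ∈ B := by
  -- `x* y` commutes with `c` iff `⟪x (c* g), y k⟫ = ⟪x g, y (c k)⟫` for all `g`, `k`
  have key : ∀ x y : G →L[ℂ] H, adjoint x ∘L y ∈ B ↔
      ∀ c : G →L[ℂ] G, (∀ b ∈ B, b * c = c * b) → ∀ g k,
        ⟪x (adjoint c g), y k⟫_ℂ = ⟪x g, y (c k)⟫_ℂ := by
    intro x y
    constructor
    · intro hxy c hc g k
      have := congrArg (fun T : G →L[ℂ] G => ⟪g, T k⟫_ℂ) (hc _ hxy)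
      simpa [adjoint_inner_right, ← adjoint_inner_left c] using this.symm
    · intro hxy
      refine mem_of_comm B fun c hc => ?_
      ext k
      refine ext_inner_left ℂ fun g => ?_
      simpa [adjoint_inner_right, ← adjoint_inner_left c] using hxy c hc g k
  have h1 : ∀ x ∈ S, ∀ y ∈ sotClosure S', adjoint x ∘L y ∈ B := by
    intro x hx y hy
    rw [key]
    intro c hc g k
    refine sotClosure_induction (fun f => ⟪x (adjoint c g), f k⟫_ℂ = ⟪x g, f (c k)⟫_ℂ) ?_ ?_ hy
    · exact isClosed_eq (by fun_prop) (by fun_prop)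
    · exact fun y hy => (key x y).mp (h x hx y hy) c hc g k
  rw [key]
  intro c hc g k
  refine sotClosure_induction (fun f => ⟪f (adjoint c g), y k⟫_ℂ = ⟪f g, y (c k)⟫_ℂ) ?_ ?_ hx
  · exact isClosed_eq (by fun_prop) (by fun_prop)
  · exact fun x hx => (key x y).mp (h1 x hx y hy) c hc g k

end SOT

section Bimodules

variable {K G : Type u} [NormedAddCommGroup K] [InnerProductSpace ℂ K] [CompleteSpace K]
  [NormedAddCommGroup G] [InnerProductSpace ℂ G] [CompleteSpace G]

/-- A strongly closed space `mod ⊆ 𝓑(G, H)` of operators which is a right module over the von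
Neumann algebra `B ⊆ 𝓑(G)` under composition, carries the `B`-valued inner product
`⟨x, y⟩ = x* y`, and is invariant under a representation `ρ` of `A` on `H`. -/
structure PreBimodule (A : VonNeumannAlgebra K) (B : VonNeumannAlgebra G) where
  /-- the Hilbert space `H` -/
  H : Type u
  [nacg : NormedAddCommGroup H]
  [ips : InnerProductSpace ℂ H]
  [cs : CompleteSpace H]
  /-- the representation of `A` on `H` which induces the left action `a x = ρ a ∘ x` -/
  ρ : A →⋆ₐ[ℂ] (H →L[ℂ] H)
  /-- the elements of the module -/
  mod : Submodule ℂ (G →L[ℂ] H)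
  right_mem : ∀ x ∈ mod, ∀ b : B, x ∘L (b : G →L[ℂ] G) ∈ mod
  left_mem : ∀ a : A, ∀ x ∈ mod, ρ a ∘L x ∈ mod
  inner_mem : ∀ x ∈ mod, ∀ y ∈ mod, adjoint x ∘L y ∈ B
  sotClosed : sotClosure mod ≤ mod

attribute [instance] PreBimodule.nacg PreBimodule.ips PreBimodule.cs

/-- A Hilbert `A`-`B`-module that is a von Neumann `B`-module, in its Stinespring representation
as a strongly closed subspace of `𝓑(G, H)`: the vectors `x g` are total in `H`, so that
`x ⊗ g ↦ x g` identifies `H` with the interior tensor product of the module with `G`. -/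
structure Bimodule (A : VonNeumannAlgebra K) (B : VonNeumannAlgebra G) extends
    PreBimodule A B where
  total : (Submodule.span ℂ {h : H | ∃ x ∈ mod, ∃ g : G, x g = h}).topologicalClosure = ⊤

/-- The representation `ρ` on `H` is normal, that is, preserves suprema of directed sets; the module
is then a von Neumann `A`-`B`-module. -/
def Bimodule.IsNormal {A : VonNeumannAlgebra K} {B : VonNeumannAlgebra G} (E : Bimodule A B) :
    Prop :=
  ScottContinuous E.ρ

namespace PreBimodule

variable {A : VonNeumannAlgebra K} {B : VonNeumannAlgebra G} (F : PreBimodule A B)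

/-- The closed linear span of the vectors `x g`. -/
def carrierSpan : Submodule ℂ F.H :=
  (Submodule.span ℂ {h : F.H | ∃ x ∈ F.mod, ∃ g : G, x g = h}).topologicalClosure

instance : CompleteSpace F.carrierSpan :=
  (Submodule.isClosed_topologicalClosure _).completeSpace_coe

lemma apply_mem_carrierSpan {x : G →L[ℂ] F.H} (hx : x ∈ F.mod) (g : G) : x g ∈ F.carrierSpan :=
  Submodule.le_topologicalClosure _ (Submodule.subset_span ⟨x, hx, g, rfl⟩)

lemma ρ_mem_carrierSpan (a : A) {h : F.H} (hh : h ∈ F.carrierSpan) : F.ρ a h ∈ F.carrierSpan := by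
  have h1 : Submodule.span ℂ {h : F.H | ∃ x ∈ F.mod, ∃ g : G, x g = h} ≤
      F.carrierSpan.comap (F.ρ a : F.H →ₗ[ℂ] F.H) := by
    rw [Submodule.span_le]
    rintro _ ⟨x, hx, g, rfl⟩
    exact F.apply_mem_carrierSpan (F.left_mem a x hx) g
  have h2 : IsClosed ((F.carrierSpan.comap (F.ρ a : F.H →ₗ[ℂ] F.H) : Submodule ℂ F.H) : Set F.H) :=
    (Submodule.isClosed_topologicalClosure _).preimage (F.ρ a).continuous
  exact Submodule.topologicalClosure_minimal _ h1 h2 hh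

/-- The restriction of `ρ a` to the closed linear span of the vectors `x g`. -/
def restrictOp (a : A) : F.carrierSpan →L[ℂ] F.carrierSpan :=
  (F.ρ a ∘L F.carrierSpan.subtypeL).codRestrict F.carrierSpan fun h => F.ρ_mem_carrierSpan a h.2

@[simp]
lemma coe_restrictOp (a : A) (h : F.carrierSpan) : (F.restrictOp a h : F.H) = F.ρ a h := rfl

/-- The restriction of the representation to the closed linear span of the vectors `x g`. -/
def restrictρ : A →⋆ₐ[ℂ] (F.carrierSpan →L[ℂ] F.carrierSpan) where
  toFun := F.restrictOp
  map_one' := by ext h; simp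
  map_mul' a b := by ext h; simp
  map_zero' := by ext h; simp
  map_add' a b := by ext h; simp
  commutes' c := by
    ext h
    simp [Algebra.algebraMap_eq_smul_one]
  map_star' a := by
    rw [star_eq_adjoint, eq_adjoint_iff]
    intro x y
    simp [Submodule.coe_inner, map_star, star_eq_adjoint, adjoint_inner_left]

/-- The same module, with `H` cut down to the closed linear span of the vectors `x g`. -/
def essential : Bimodule A B where
  H := F.carrierSpan
  ρ := F.restrictρ
  mod :=
    { carrier := {x | F.carrierSpan.subtypeL ∘L x ∈ F.mod}
      add_mem' := fun {x y} hx hy => by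
        simpa only [Set.mem_ofPred_eq, comp_add] using add_mem hx hy
      zero_mem' := by simp
      smul_mem' := fun c x hx => by
        simpa only [Set.mem_ofPred_eq, comp_smul] using F.mod.smul_mem c hx }
  right_mem x hx b := F.right_mem _ hx b
  left_mem a x hx := F.left_mem a _ hx
  inner_mem x hx y hy := by
    have := F.inner_mem _ hx _ hy
    convert this using 1
    ext g
    refine ext_inner_left ℂ fun k => ?_
    simp [adjoint_inner_right]
  sotClosed x hx := F.sotClosed (sotClosure_map F.carrierSpan.subtypeL (ContinuousLinearMap.id ℂ G)
    (fun y hy => hy) hx)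
  total := by
    rw [Submodule.topologicalClosure_eq_top_iff, Submodule.eq_bot_iff]
    intro w hw
    have h1 : ∀ v ∈ F.carrierSpan, ⟪v, (w : F.H)⟫_ℂ = 0 := by
      have hle : F.carrierSpan ≤ (Submodule.span ℂ {(w : F.H)})ᗮ := by
        refine Submodule.topologicalClosure_minimal _ ?_ (Submodule.isClosed_orthogonal _)
        rw [Submodule.span_le]
        rintro _ ⟨x, hx, g, rfl⟩
        refine Submodule.mem_orthogonal_singleton_iff_inner_left.mpr ?_
        exact hw ⟨x g, F.apply_mem_carrierSpan hx g⟩ (Submodule.subset_span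
          ⟨x.codRestrict F.carrierSpan (F.apply_mem_carrierSpan hx), hx, g, rfl⟩)
      exact fun v hv => Submodule.mem_orthogonal_singleton_iff_inner_left.mp (hle hv)
    exact Subtype.ext (inner_self_eq_zero.mp (h1 w w.2))

/-- An element of a module, regarded as an element of the module with `H` cut down. -/
def essentialVec {x : G →L[ℂ] F.H} (hx : x ∈ F.mod) : F.essential.mod :=
  ⟨x.codRestrict F.carrierSpan (F.apply_mem_carrierSpan hx), hx⟩

/-- The strong closure of the linear span of `A ξ B` in `F`. -/
def cyclicSub {ξ : G →L[ℂ] F.H} (hξ : ξ ∈ F.mod) : PreBimodule A B where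
  H := F.H
  ρ := F.ρ
  mod := sotClosure (Submodule.span ℂ
    {y | ∃ (a : A) (b : B), y = F.ρ a ∘L ξ ∘L (b : G →L[ℂ] G)})
  right_mem x hx b := by
    refine sotClosure_map (ContinuousLinearMap.id ℂ F.H) (b : G →L[ℂ] G) (fun y hy => ?_) hx
    induction hy using Submodule.span_induction with
    | mem y hy =>
      obtain ⟨a, b', rfl⟩ := hy
      exact Submodule.subset_span ⟨a, b' * b, rfl⟩
    | zero => simp
    | add y z _ _ hy hz => simpa using add_mem hy hz
    | smul c y _ hy => simpa using Submodule.smul_mem _ c hy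
  left_mem a x hx := by
    refine sotClosure_map (F.ρ a) (ContinuousLinearMap.id ℂ G) (fun y hy => ?_) hx
    induction hy using Submodule.span_induction with
    | mem y hy =>
      obtain ⟨a', b, rfl⟩ := hy
      refine Submodule.subset_span ⟨a * a', b, ?_⟩
      rw [map_mul]
      rfl
    | zero => simp
    | add y z _ _ hy hz => simpa using add_mem hy hz
    | smul c y _ hy => simpa using Submodule.smul_mem _ c hy
  inner_mem x hx y hy := by
    have hle : Submodule.span ℂ {y | ∃ (a : A) (b : B), y = F.ρ a ∘L ξ ∘L (b : G →L[ℂ] G)} ≤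
        F.mod := by
      rw [Submodule.span_le]
      rintro _ ⟨a, b, rfl⟩
      exact F.left_mem a _ (F.right_mem ξ hξ b)
    exact F.inner_mem x (F.sotClosed (sotClosure_mono hle hx)) y
      (F.sotClosed (sotClosure_mono hle hy))
  sotClosed := sotClosure_idem _

lemma mem_cyclicSub {ξ : G →L[ℂ] F.H} (hξ : ξ ∈ F.mod) : ξ ∈ (F.cyclicSub hξ).mod :=
  le_sotClosure _ (Submodule.subset_span ⟨1, 1, by rw [map_one]; rfl⟩)

end PreBimodule

section Corner

variable {A : VonNeumannAlgebra K} {B : VonNeumannAlgebra G} {C : VonNeumannAlgebra G}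

/-- For an `M₂(A)`-`C`-module `F`, the `A`-`C`-module `𝔼ᵢᵢ F`, where `a ∈ A` acts
as `diag(a, a)`. -/
def PreBimodule.corner (F : PreBimodule (M2 A) C) (i : Fin 2) : PreBimodule A C where
  H := F.H
  ρ := F.ρ.comp (M2.diag A)
  mod :=
    { carrier := {x | ∃ y ∈ F.mod, x = F.ρ (M2.unit A i i) ∘L y}
      add_mem' := by
        rintro _ _ ⟨y, hy, rfl⟩ ⟨z, hz, rfl⟩
        exact ⟨y + z, add_mem hy hz, (comp_add _ _ _).symm⟩
      zero_mem' := ⟨0, zero_mem _, by simp⟩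
      smul_mem' := by
        rintro c _ ⟨y, hy, rfl⟩
        exact ⟨c • y, F.mod.smul_mem c hy, (comp_smul _ _ _).symm⟩ }
  right_mem := by
    rintro _ ⟨y, hy, rfl⟩ b
    exact ⟨_, F.right_mem y hy b, rfl⟩
  left_mem := by
    rintro a _ ⟨y, hy, rfl⟩
    refine ⟨_, F.left_mem (M2.diag A a) y hy, ?_⟩
    have h : M2.diag A a * M2.unit A i i = M2.unit A i i * M2.diag A a := M2.diag_mul_unit a i i
    have := congrArg F.ρ h
    rw [map_mul, map_mul] at this
    ext g
    exact congrArg (fun T : F.H →L[ℂ] F.H => T (y g)) this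
  inner_mem := by
    rintro _ ⟨y, hy, rfl⟩ _ ⟨z, hz, rfl⟩
    exact F.inner_mem _ (F.left_mem _ y hy) _ (F.left_mem _ z hz)
  sotClosed := by
    intro x hx
    have h1 : x ∈ F.mod := by
      refine F.sotClosed (sotClosure_mono ?_ hx)
      rintro _ ⟨y, hy, rfl⟩
      exact F.left_mem _ y hy
    refine ⟨x, h1, ?_⟩
    have h2 := sotClosure_induction (fun f => f = fun g => F.ρ (M2.unit A i i) (f g))
      (isClosed_eq continuous_id (by fun_prop)) ?_ hx
    · ext g
      exact congrFun h2 g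
    · rintro _ ⟨y, hy, rfl⟩
      funext g
      have := congrArg F.ρ (M2.unit_mul_self (B := A) i)
      rw [map_mul] at this
      exact (congrArg (fun T : F.H →L[ℂ] F.H => T (y g)) this).symm

/-- The diagonal map `g ↦ (g, g)` from `G` to `G ⊕ G`. -/
def dbl (G : Type u) [NormedAddCommGroup G] [InnerProductSpace ℂ G] [CompleteSpace G] :
    G →L[ℂ] Sq G :=
  inj G 0 + inj G 1

lemma dbl_comp (b : B) : dbl G ∘L (b : G →L[ℂ] G) = (M2.diag B b : Sq G →L[ℂ] Sq G) ∘L dbl G := by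
  ext g i
  fin_cases i <;> simp [dbl, M2.diag, M2.of, inj_apply]

/-- The inner product of `x ∘ dbl` and `y ∘ dbl` is the sum of the four entries of `⟨x, y⟩`. -/
lemma dbl_inner {H : Type*} [NormedAddCommGroup H] [InnerProductSpace ℂ H] [CompleteSpace H]
    (x y : Sq G →L[ℂ] H) :
    adjoint (x ∘L dbl G) ∘L (y ∘L dbl G) = ∑ i, ∑ j, entry i j (adjoint x ∘L y) := by
  ext g
  simp [dbl, adjoint_comp, entry, inj]
  abel

/-- For an `A`-`M₂(B)`-module `F`, the `A`-`B`-module `F^(B)`: the quotient of `F` by the kernel of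
the semi-inner product `⟨x, y⟩_Σ = ∑ᵢⱼ ⟨x, y⟩ᵢⱼ`, where `b ∈ B` acts on the right as `diag(b, b)`.
The class `[x]` is represented by the operator `g ↦ x (g, g)`; indeed
`(x ∘ dbl)* (y ∘ dbl) = ∑ᵢⱼ ⟨x, y⟩ᵢⱼ`, see `dbl_inner`. -/
def PreBimodule.collapse (F : PreBimodule A (M2 B)) : PreBimodule A B where
  H := F.H
  ρ := F.ρ
  mod :=
    { carrier := {z | ∃ x ∈ F.mod, z = x ∘L dbl G}
      add_mem' := by
        rintro _ _ ⟨y, hy, rfl⟩ ⟨z, hz, rfl⟩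
        exact ⟨y + z, add_mem hy hz, (add_comp _ _ _).symm⟩
      zero_mem' := ⟨0, zero_mem _, by simp⟩
      smul_mem' := by
        rintro c _ ⟨y, hy, rfl⟩
        exact ⟨c • y, F.mod.smul_mem c hy, (smul_comp _ _ _).symm⟩ }
  right_mem := by
    rintro _ ⟨x, hx, rfl⟩ b
    refine ⟨_, F.right_mem x hx (M2.diag B b), ?_⟩
    rw [comp_assoc, comp_assoc, dbl_comp]
  left_mem := by
    rintro a _ ⟨x, hx, rfl⟩
    exact ⟨_, F.left_mem a x hx, rfl⟩
  inner_mem := by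
    rintro _ ⟨x, hx, rfl⟩ _ ⟨y, hy, rfl⟩
    rw [dbl_inner]
    exact sum_mem fun i _ => sum_mem fun j _ => F.inner_mem x hx y hy i j
  sotClosed := by
    intro z hz
    -- with `s (g, k) = g + k`, the operator `z ∘ s` lies in `F`, and `z = (z ∘ s / 2) ∘ dbl`
    refine ⟨(1 / 2 : ℂ) • (z ∘L (prj G 0 + prj G 1)), F.mod.smul_mem _ (F.sotClosed ?_), ?_⟩
    · refine sotClosure_map (ContinuousLinearMap.id ℂ F.H) (prj G 0 + prj G 1) ?_ hz
      rintro _ ⟨x, hx, rfl⟩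
      convert F.right_mem x hx (M2.of fun _ _ => 1) using 1
      ext v
      simp [dbl, M2.of, add_assoc, add_left_comm]
    · ext g
      simp [dbl, inj_apply, ← two_smul ℂ, smul_smul]

end Corner
end Bimodules

section Gram

variable {G : Type u} [NormedAddCommGroup G] [InnerProductSpace ℂ G] [CompleteSpace G]
  {H : Type*} [NormedAddCommGroup H] [InnerProductSpace ℂ H] [CompleteSpace H]

lemma negPart_facts {R : Type*} [NonUnitalCStarAlgebra R] [PartialOrder R] [StarOrderedRing R]
    (M : R) (hM : IsSelfAdjoint M) :
    ∃ N : R, star N = N ∧ N * M * N = -(N * N * N) ∧ (∃ D : R, N * N * N = star D * D) ∧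
      (N * N * N = 0 → 0 ≤ M) := by
  have hN : 0 ≤ M⁻ := CFC.negPart_nonneg M
  have hNs : star M⁻ = M⁻ := hN.isSelfAdjoint.star_eq
  refine ⟨M⁻, hNs, ?_, ?_, ?_⟩
  · conv_lhs => enter [1, 2]; rw [← CFC.posPart_sub_negPart M hM]
    rw [mul_assoc, sub_mul, CFC.posPart_mul_negPart, zero_sub, mul_neg, mul_assoc]
  · have := star_left_conjugate_nonneg hN M⁻
    rw [hNs] at this
    exact CStarAlgebra.nonneg_iff_eq_star_mul_self.mp this
  · intro h3
    have h4 : star (M⁻ * M⁻) * (M⁻ * M⁻) = 0 := by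
      rw [star_mul, hNs, ← mul_assoc, h3, zero_mul]
    have h5 : star M⁻ * M⁻ = 0 := by
      rw [hNs]; exact (CStarRing.star_mul_self_eq_zero_iff _).mp h4
    exact (CFC.negPart_eq_zero_iff M hM).mp ((CStarRing.star_mul_self_eq_zero_iff _).mp h5)

lemma exists_star_mul_self {R : Type*} [NonUnitalCStarAlgebra R] [PartialOrder R]
    [StarOrderedRing R] {M : R} (hM : 0 ≤ M) : ∃ D : R, M = star D * D :=
  CStarAlgebra.nonneg_iff_eq_star_mul_self.mp hM

/-- A matrix `M` over a C*-algebra is positive if `∑ᵢⱼ (bᵢ)* Mᵢⱼ bⱼ` is positive for all `b`. -/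
lemma cstarMatrix_nonneg {R n : Type*} [CStarAlgebra R] [PartialOrder R] [StarOrderedRing R]
    [Fintype n] [DecidableEq n] (M : CStarMatrix n n R) (hM : star M = M)
    (h : ∀ b : n → R, 0 ≤ ∑ i, ∑ j, star (b i) * M i j * b j) : 0 ≤ M := by
  obtain ⟨N, hNs, hNM, ⟨D, hD⟩, hN0⟩ := negPart_facts (R := CStarMatrix n n R) M hM
  refine hN0 ?_
  have hdiag : ∀ k, (star D * D) k k = 0 := by
    intro k
    refine le_antisymm ?_ ?_
    · have h1 := h fun i => N i k
      have h2 : ∑ i, ∑ j, star (N i k) * M i j * N j k = (star N * M * N) k k := by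
        simp only [CStarMatrix.mul_apply, Finset.sum_mul]
        rw [Finset.sum_comm]
        rfl
      rw [h2, hNs, hNM, hD] at h1
      exact neg_nonneg.mp h1
    · rw [CStarMatrix.mul_apply]
      exact Finset.sum_nonneg fun l _ => star_mul_self_nonneg (D l k)
  have hD0 : D = 0 := by
    apply CStarMatrix.ext
    intro l k
    have h1 := hdiag k
    rw [CStarMatrix.mul_apply] at h1
    have h2 := (Finset.sum_eq_zero_iff_of_nonneg
      (fun l _ => star_mul_self_nonneg (D l k))).mp h1 l (Finset.mem_univ l)
    exact CStarRing.star_mul_self_eq_zero_iff _ |>.mp h2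
  rw [hD, hD0]
  exact mul_zero _

/-- A Gram matrix `(yᵢ* yⱼ)` with entries in `B` factorizes as `D* D` over `B`. -/
lemma gram_factor (B : VonNeumannAlgebra G) {n : Type*} [Fintype n] [DecidableEq n]
    (y : n → G →L[ℂ] H) (hy : ∀ i j, adjoint (y i) ∘L y j ∈ B) :
    ∃ D : n → n → B, ∀ i j, (⟨adjoint (y i) ∘L y j, hy i j⟩ : B) = ∑ k, star (D k i) * D k j := by
  let M : CStarMatrix n n B := CStarMatrix.ofMatrix fun i j => ⟨adjoint (y i) ∘L y j, hy i j⟩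
  have hMs : star M = M := by
    apply CStarMatrix.ext
    intro i j
    refine Subtype.ext ?_
    change star (adjoint (y j) ∘L y i) = adjoint (y i) ∘L y j
    rw [star_eq_adjoint, adjoint_comp, adjoint_adjoint]
  have hM : 0 ≤ M := by
    refine cstarMatrix_nonneg M hMs fun b => ?_
    have h1 : ((∑ i, ∑ j, star (b i) * M i j * b j : B) : G →L[ℂ] G) =
        adjoint (∑ i, y i ∘L (b i : G →L[ℂ] G)) ∘L (∑ j, y j ∘L (b j : G →L[ℂ] G)) := by
      have h2 : ∀ i j, ((star (b i) * M i j * b j : B) : G →L[ℂ] G) =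
          adjoint (y i ∘L (b i : G →L[ℂ] G)) ∘L (y j ∘L (b j : G →L[ℂ] G)) := by
        intro i j
        rw [adjoint_comp]
        rfl
      simp only [AddSubmonoidClass.coe_finsetSum, h2]
      ext g
      simp only [sum_apply, comp_apply, map_sum]
      exact Finset.sum_comm
    change (0 : G →L[ℂ] G) ≤ _
    rw [h1, ContinuousLinearMap.nonneg_iff_isPositive]
    exact ContinuousLinearMap.isPositive_adjoint_comp_self _
  obtain ⟨D, hD⟩ := exists_star_mul_self hM
  refine ⟨fun i j => D i j, fun i j => ?_⟩
  have := congrFun (congrFun hD i) j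
  exact this.trans CStarMatrix.mul_apply

lemma gram_quad (B : VonNeumannAlgebra G) {n : Type*} [Fintype n]
    {D : n → n → B} {m : n → n → B} (hm : ∀ i j, m i j = ∑ k, star (D k i) * D k j)
    {L : Type*} [NormedAddCommGroup L] [InnerProductSpace ℂ L] [CompleteSpace L]
    (π : B →⋆ₐ[ℂ] (L →L[ℂ] L)) (v : n → L) :
    ∑ i, ∑ j, ⟪π (m j i) (v i), v j⟫_ℂ = ((∑ k, ‖∑ i, π (D k i) (v i)‖ ^ 2 : ℝ) : ℂ) := by
  have h1 : ∀ i j, ⟪π (m j i) (v i), v j⟫_ℂ = ∑ k, ⟪π (D k i) (v i), π (D k j) (v j)⟫_ℂ := by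
    intro i j
    simp [hm, map_sum, map_mul, map_star, star_eq_adjoint, adjoint_inner_left]
  have h2 : ∀ k, ((‖∑ i, π (D k i) (v i)‖ ^ 2 : ℝ) : ℂ) =
      ∑ i, ∑ j, ⟪π (D k i) (v i), π (D k j) (v j)⟫_ℂ := by
    intro k
    rw [Complex.ofReal_pow]
    refine (inner_self_eq_norm_sq_to_K (𝕜 := ℂ) (∑ i, π (D k i) (v i))).symm.trans ?_
    rw [sum_inner (𝕜 := ℂ)]
    exact Finset.sum_congr rfl fun i _ => inner_sum (𝕜 := ℂ) _ _ _
  rw [Complex.ofReal_sum]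
  simp only [h1, h2]
  exact (Finset.sum_congr rfl fun i _ => Finset.sum_comm).trans Finset.sum_comm

end Gram

section Tensor

variable {K K' G L L' : Type u}
  [NormedAddCommGroup K] [InnerProductSpace ℂ K] [CompleteSpace K]
  [NormedAddCommGroup K'] [InnerProductSpace ℂ K'] [CompleteSpace K']
  [NormedAddCommGroup G] [InnerProductSpace ℂ G] [CompleteSpace G]
  [NormedAddCommGroup L] [InnerProductSpace ℂ L] [CompleteSpace L]
  [NormedAddCommGroup L'] [InnerProductSpace ℂ L'] [CompleteSpace L']
  {A : VonNeumannAlgebra K} {A' : VonNeumannAlgebra K'} {B : VonNeumannAlgebra G}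
  {C : VonNeumannAlgebra L} {C' : VonNeumannAlgebra L'}

/-- The `B`-valued inner product `⟨x, y⟩ = x* y` of a module. -/
def PreBimodule.inn (E : PreBimodule A B) (x y : E.mod) : B :=
  ⟨adjoint (x : G →L[ℂ] E.H) ∘L (y : G →L[ℂ] E.H), E.inner_mem _ x.2 _ y.2⟩

lemma PreBimodule.star_inn (E : PreBimodule A B) (x y : E.mod) : star (E.inn x y) = E.inn y x :=
  Subtype.ext <| by
    change star (adjoint (x : G →L[ℂ] E.H) ∘L (y : G →L[ℂ] E.H)) = _
    rw [star_eq_adjoint, adjoint_comp, adjoint_adjoint]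
    rfl

/-- The kernel `(x, y) ↦ ρ(⟨x, y⟩)`. -/
def kerMat (E : PreBimodule A B) (F : PreBimodule B C) : Matrix E.mod E.mod (F.H →L[ℂ] F.H) :=
  Matrix.of fun x y => F.ρ (E.inn x y)

lemma kerMat_posSemidef (E : PreBimodule A B) (F : PreBimodule B C) :
    (kerMat E F).PosSemidef := by
  have hiff := (RKHS.posSemidef_tfae (K := kerMat E F)).out 0 2
  refine hiff.mpr ⟨?_, fun vv => ?_⟩
  · ext1 x y
    change star (F.ρ (E.inn y x)) = F.ρ (E.inn x y)
    rw [← map_star, E.star_inn]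
  · classical
    obtain ⟨D, hD⟩ := gram_factor B (fun i : vv.support => ((i : E.mod) : G →L[ℂ] E.H))
      (fun i j => E.inner_mem _ i.1.2 _ j.1.2)
    have h := gram_quad B (m := fun i j : vv.support => E.inn i j) hD F.ρ (fun i => vv i)
    have h2 : (vv.sum fun x w => vv.sum fun x' w' => ⟪kerMat E F x' x w, w'⟫_ℂ) =
        ∑ i : vv.support, ∑ j : vv.support, ⟪F.ρ (E.inn j i) (vv i), vv j⟫_ℂ := by
      simp only [Finsupp.sum]
      rw [← Finset.sum_coe_sort]
      refine Finset.sum_congr rfl fun i _ => ?_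
      rw [← Finset.sum_coe_sort]
      rfl
    rw [h2, h]
    change 0 ≤ ∑ k, ‖∑ i, F.ρ (D k i) (vv i)‖ ^ 2
    exact Finset.sum_nonneg fun k _ => sq_nonneg _

instance instFactKerMat (E : PreBimodule A B) (F : PreBimodule B C) :
    Fact (kerMat E F).PosSemidef := ⟨kerMat_posSemidef E F⟩

/-- The interior tensor product of `E` with the Hilbert space `F.H`: the Hilbert space generated by
vectors `x ⊗ h` with `⟪x ⊗ h, y ⊗ k⟫ = ⟪h, ⟨x, y⟩ k⟫`. -/
def TensorH (E : PreBimodule A B) (F : PreBimodule B C) : Type u := RKHS.OfKernel (kerMat E F)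

variable (E : PreBimodule A B) (F : PreBimodule B C)

instance : NormedAddCommGroup (TensorH E F) :=
  inferInstanceAs (NormedAddCommGroup (RKHS.OfKernel (kerMat E F)))

instance : InnerProductSpace ℂ (TensorH E F) :=
  inferInstanceAs (InnerProductSpace ℂ (RKHS.OfKernel (kerMat E F)))

instance : CompleteSpace (TensorH E F) :=
  inferInstanceAs (CompleteSpace (RKHS.OfKernel (kerMat E F)))

instance : RKHS ℂ (TensorH E F) E.mod F.H :=
  inferInstanceAs (RKHS ℂ (RKHS.OfKernel (kerMat E F)) E.mod F.H)

/-- The operator `h ↦ x ⊗ h`. -/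
def tmulOp (x : E.mod) : F.H →L[ℂ] TensorH E F := RKHS.kerFun (TensorH E F) x

lemma inner_tmulOp (x y : E.mod) (h k : F.H) :
    ⟪tmulOp E F x h, tmulOp E F y k⟫_ℂ = ⟪h, F.ρ (E.inn x y) k⟫_ℂ := by
  have h1 := RKHS.kernel_inner (TensorH E F) y x h k
  have h2 : RKHS.kernel (TensorH E F) = kerMat E F := RKHS.OfKernel.kernel_ofKernel
  rw [h2] at h1
  refine h1.symm.trans ?_
  change ⟪F.ρ (E.inn y x) h, k⟫_ℂ = _
  rw [← E.star_inn, map_star, star_eq_adjoint, adjoint_inner_left]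

lemma tmulOp_dense :
    (Submodule.span ℂ {z | ∃ (x : E.mod) (h : F.H), tmulOp E F x h = z}).topologicalClosure = ⊤ :=
  RKHS.kerFun_dense (TensorH E F)

lemma norm_sum_tmulOp {n : Type*} [Fintype n] (x : n → E.mod) (v : n → F.H) :
    ((‖∑ i, tmulOp E F (x i) (v i)‖ ^ 2 : ℝ) : ℂ) =
      ∑ i, ∑ j, ⟪F.ρ (E.inn (x j) (x i)) (v i), v j⟫_ℂ := by
  rw [Complex.ofReal_pow]
  refine (inner_self_eq_norm_sq_to_K (𝕜 := ℂ) (∑ i, tmulOp E F (x i) (v i))).symm.trans ?_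
  rw [sum_inner (𝕜 := ℂ)]
  refine Finset.sum_congr rfl fun i _ => ?_
  rw [inner_sum (𝕜 := ℂ)]
  refine Finset.sum_congr rfl fun j _ => ?_
  rw [inner_tmulOp, ← E.star_inn (x i) (x j), map_star, star_eq_adjoint, adjoint_inner_left]

variable {E F} {E' : PreBimodule A' B} {F' : PreBimodule B C'}

lemma norm_sum_right {n : Type*} [Fintype n] (S : F.H →L[ℂ] F'.H)
    (hS : ∀ b h, S (F.ρ b h) = F'.ρ b (S h)) (x : n → E.mod) (v : n → F.H) :
    ‖∑ i, tmulOp E F' (x i) (S (v i))‖ ≤ ‖S‖ * ‖∑ i, tmulOp E F (x i) (v i)‖ := by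
  classical
  obtain ⟨D, hD⟩ := gram_factor B (fun i => ((x i : E.mod) : G →L[ℂ] E.H))
      (fun i j => E.inner_mem _ (x i).2 _ (x j).2)
  have h1 := gram_quad B (m := fun i j => E.inn (x i) (x j)) hD F.ρ v
  have h2 := gram_quad B (m := fun i j => E.inn (x i) (x j)) hD F'.ρ (fun i => S (v i))
  rw [← norm_sum_tmulOp, Complex.ofReal_inj] at h1 h2
  refine le_of_sq_le_sq ?_ (by positivity)
  rw [mul_pow, h1, h2, Finset.mul_sum]
  refine Finset.sum_le_sum fun k _ => ?_
  have h3 : ∑ i, F'.ρ (D k i) (S (v i)) = S (∑ i, F.ρ (D k i) (v i)) := by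
    rw [map_sum]
    exact Finset.sum_congr rfl fun i _ => (hS _ _).symm
  rw [h3, ← mul_pow]
  exact pow_le_pow_left₀ (norm_nonneg _) (S.le_opNorm _) 2

lemma norm_sum_left {n : Type*} [Fintype n] (T : E.H →L[ℂ] E'.H)
    (hT : ∀ x ∈ E.mod, T ∘L x ∈ E'.mod) (x : n → E.mod) (v : n → F.H) :
    ‖∑ i, tmulOp E' F ⟨T ∘L (x i : G →L[ℂ] E.H), hT _ (x i).2⟩ (v i)‖ ≤
      ‖T‖ * ‖∑ i, tmulOp E F (x i) (v i)‖ := by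
  classical
  have hpos : (0 : E.H →L[ℂ] E.H) ≤ ((‖T‖ ^ 2 : ℝ) : ℂ) • 1 - adjoint T ∘L T := by
    rw [ContinuousLinearMap.nonneg_iff_isPositive, isPositive_iff_complex]
    intro v
    have h1 : ⟪(((‖T‖ ^ 2 : ℝ) : ℂ) • (1 : E.H →L[ℂ] E.H) - adjoint T ∘L T) v, v⟫_ℂ =
        ((‖T‖ ^ 2 * ‖v‖ ^ 2 - ‖T v‖ ^ 2 : ℝ) : ℂ) := by
      simp only [sub_apply, smul_apply, one_apply_eq_self, comp_apply, inner_sub_left,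
        inner_smul_left, adjoint_inner_left, Complex.conj_ofReal]
      rw [inner_self_eq_norm_sq_to_K, inner_self_eq_norm_sq_to_K]
      push_cast
      rfl
    rw [h1]
    refine ⟨rfl, ?_⟩
    change 0 ≤ ‖T‖ ^ 2 * ‖v‖ ^ 2 - ‖T v‖ ^ 2
    rw [← mul_pow, sub_nonneg]
    exact pow_le_pow_left₀ (norm_nonneg _) (T.le_opNorm v) 2
  obtain ⟨R, hR⟩ := exists_star_mul_self hpos
  let T' : n → E'.mod := fun i => ⟨T ∘L (x i : G →L[ℂ] E.H), hT _ (x i).2⟩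
  have hz : ∀ i j, adjoint (R ∘L (x i : G →L[ℂ] E.H)) ∘L (R ∘L (x j : G →L[ℂ] E.H)) =
      ((((‖T‖ ^ 2 : ℝ) : ℂ) • E.inn (x i) (x j) - E'.inn (T' i) (T' j) : B) : G →L[ℂ] G) := by
    intro i j
    have h1 : adjoint (R ∘L (x i : G →L[ℂ] E.H)) ∘L (R ∘L (x j : G →L[ℂ] E.H)) =
        adjoint (x i : G →L[ℂ] E.H) ∘L (star R * R) ∘L (x j : G →L[ℂ] E.H) := by
      rw [adjoint_comp]; rfl
    rw [h1, ← hR]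
    change _ = ((‖T‖ ^ 2 : ℝ) : ℂ) • (adjoint (x i : G →L[ℂ] E.H) ∘L (x j : G →L[ℂ] E.H)) -
      adjoint (T ∘L (x i : G →L[ℂ] E.H)) ∘L (T ∘L (x j : G →L[ℂ] E.H))
    rw [adjoint_comp]
    ext g
    simp
  obtain ⟨D, hD⟩ := gram_factor B (fun i => R ∘L (x i : G →L[ℂ] E.H))
    (fun i j => by rw [hz]; exact Subtype.property _)
  have hD' : ∀ i j, ((‖T‖ ^ 2 : ℝ) : ℂ) • E.inn (x i) (x j) - E'.inn (T' i) (T' j) =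
      ∑ k, star (D k i) * D k j := fun i j => by
    rw [← hD]; exact Subtype.ext (hz i j).symm
  have h1 := gram_quad B hD' F.ρ v
  have h2 := norm_sum_tmulOp E F x v
  have h3 := norm_sum_tmulOp E' F T' v
  have h4 : ∑ i, ∑ j, ⟪F.ρ (((‖T‖ ^ 2 : ℝ) : ℂ) • E.inn (x j) (x i) - E'.inn (T' j) (T' i)) (v i),
      v j⟫_ℂ = ((‖T‖ ^ 2 : ℝ) : ℂ) * ((‖∑ i, tmulOp E F (x i) (v i)‖ ^ 2 : ℝ) : ℂ) -
        ((‖∑ i, tmulOp E' F (T' i) (v i)‖ ^ 2 : ℝ) : ℂ) := by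
    rw [h2, h3, Finset.mul_sum, ← Finset.sum_sub_distrib]
    refine Finset.sum_congr rfl fun i _ => ?_
    rw [Finset.mul_sum, ← Finset.sum_sub_distrib]
    refine Finset.sum_congr rfl fun j _ => ?_
    rw [map_sub, map_smul, sub_apply, smul_apply, inner_sub_left, inner_smul_left,
      Complex.conj_ofReal]
  rw [h1, ← Complex.ofReal_mul, ← Complex.ofReal_sub, Complex.ofReal_inj] at h4
  have h5 : 0 ≤ ∑ k, ‖∑ i, F.ρ (D k i) (v i)‖ ^ 2 := Finset.sum_nonneg fun k _ => sq_nonneg _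
  refine le_of_sq_le_sq ?_ (by positivity)
  rw [mul_pow]
  linarith

variable (E F) in
/-- Finite sums of vectors `x ⊗ h`. -/
def sumMap : (E.mod →₀ F.H) →ₗ[ℂ] TensorH E F :=
  Finsupp.lsum ℂ fun x => (tmulOp E F x : F.H →ₗ[ℂ] TensorH E F)

lemma sumMap_denseRange : DenseRange (sumMap E F) := by
  have h1 : Submodule.span ℂ {z | ∃ (x : E.mod) (h : F.H), tmulOp E F x h = z} ≤
      LinearMap.range (sumMap E F) := by
    rw [Submodule.span_le]
    rintro _ ⟨x, h, rfl⟩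
    exact ⟨Finsupp.single x h, by simp [sumMap]⟩
  have h2 : (LinearMap.range (sumMap E F)).topologicalClosure = ⊤ :=
    top_le_iff.mp ((tmulOp_dense E F).symm.le.trans (Submodule.topologicalClosure_mono h1))
  exact Submodule.dense_iff_topologicalClosure_eq_top.mpr h2

/-- The bounded operator `x ⊗ h ↦ T x ⊗ S h`. -/
def tensorOp (T : E.H →L[ℂ] E'.H) (hT : ∀ x ∈ E.mod, T ∘L x ∈ E'.mod) (S : F.H →L[ℂ] F'.H) :
    TensorH E F →L[ℂ] TensorH E' F' :=
  LinearMap.extendOfNorm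
    (Finsupp.lsum ℂ fun x : E.mod =>
      (tmulOp E' F' ⟨T ∘L (x : G →L[ℂ] E.H), hT _ x.2⟩ ∘L S : F.H →ₗ[ℂ] TensorH E' F'))
    (sumMap E F)

lemma tensorOp_tmulOp (T : E.H →L[ℂ] E'.H) (hT : ∀ x ∈ E.mod, T ∘L x ∈ E'.mod)
    (S : F.H →L[ℂ] F'.H) (hS : ∀ b h, S (F.ρ b h) = F'.ρ b (S h)) (x : E.mod) (h : F.H) :
    tensorOp T hT S (tmulOp E F x h) =
      tmulOp E' F' ⟨T ∘L (x : G →L[ℂ] E.H), hT _ x.2⟩ (S h) := by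
  have key := LinearMap.extendOfNorm_eq (f := Finsupp.lsum ℂ fun x : E.mod =>
      (tmulOp E' F' ⟨T ∘L (x : G →L[ℂ] E.H), hT _ x.2⟩ ∘L S : F.H →ₗ[ℂ] TensorH E' F'))
      (e := sumMap E F) sumMap_denseRange ⟨‖T‖ * ‖S‖, fun vv => ?_⟩ (Finsupp.single x h)
  · simpa [sumMap, tensorOp] using key
  · have h1 := norm_sum_left (F := F') T hT (fun i : vv.support => (i : E.mod)) (fun i => S (vv i))
    have h2 := norm_sum_right (E := E) S hS (fun i : vv.support => (i : E.mod)) (fun i => vv i)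
    have h3 := h1.trans (mul_le_mul_of_nonneg_left h2 (norm_nonneg T))
    rw [← mul_assoc] at h3
    simp only [sumMap, Finsupp.lsum_apply, Finsupp.sum]
    rw [← Finset.sum_coe_sort, ← Finset.sum_coe_sort (s := vv.support)]
    exact h3

end Tensor

section TensorBimodule

variable {K G L : Type u}
  [NormedAddCommGroup K] [InnerProductSpace ℂ K] [CompleteSpace K]
  [NormedAddCommGroup G] [InnerProductSpace ℂ G] [CompleteSpace G]
  [NormedAddCommGroup L] [InnerProductSpace ℂ L] [CompleteSpace L]
  {A : VonNeumannAlgebra K} {B : VonNeumannAlgebra G} {C : VonNeumannAlgebra L}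

lemma tensorH_ext {E : PreBimodule A B} {F : PreBimodule B C} {M : Type*} [NormedAddCommGroup M]
    [NormedSpace ℂ M] {S T : TensorH E F →L[ℂ] M}
    (h : ∀ x k, S (tmulOp E F x k) = T (tmulOp E F x k)) : S = T := by
  refine ContinuousLinearMap.ext_on
    (Submodule.dense_iff_topologicalClosure_eq_top.mpr (tmulOp_dense E F)) ?_
  rintro _ ⟨x, k, rfl⟩
  exact h x k

lemma tensorH_ext_inner {E : PreBimodule A B} {F : PreBimodule B C} {v w : TensorH E F}
    (h : ∀ x k, ⟪tmulOp E F x k, v⟫_ℂ = ⟪tmulOp E F x k, w⟫_ℂ) : v = w := by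
  refine ext_inner_left ℂ fun z => ?_
  have h1 : innerSL ℂ v = innerSL ℂ w := tensorH_ext fun x k => by
    simp only [innerSL_apply_apply]
    rw [← inner_conj_symm, h, inner_conj_symm]
  have h2 := congrArg (fun f => f z) h1
  simp only [innerSL_apply_apply] at h2
  rw [← inner_conj_symm, h2, inner_conj_symm]

lemma tmulOp_add (E : PreBimodule A B) (F : PreBimodule B C) (x y : E.mod) :
    tmulOp E F (x + y) = tmulOp E F x + tmulOp E F y := by
  refine ContinuousLinearMap.ext fun h => tensorH_ext_inner fun z k => ?_
  have h1 : E.inn z (x + y) = E.inn z x + E.inn z y :=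
    Subtype.ext (by simp [PreBimodule.inn])
  rw [add_apply, inner_add_right, inner_tmulOp, inner_tmulOp, inner_tmulOp, h1, map_add, add_apply,
    inner_add_right]

lemma tmulOp_smul (E : PreBimodule A B) (F : PreBimodule B C) (c : ℂ) (x : E.mod) :
    tmulOp E F (c • x) = c • tmulOp E F x := by
  refine ContinuousLinearMap.ext fun h => tensorH_ext_inner fun z k => ?_
  have h1 : E.inn z (c • x) = c • E.inn z x := Subtype.ext (by simp [PreBimodule.inn])
  rw [smul_apply, inner_smul_right, inner_tmulOp, inner_tmulOp, h1, map_smul, smul_apply,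
    inner_smul_right]

/-- The left action `a (x ⊗ h) = a x ⊗ h` of `A` on the Hilbert space of vectors `x ⊗ h`. -/
def tensorρ (E : PreBimodule A B) (F : PreBimodule B C) :
    A →⋆ₐ[ℂ] (TensorH E F →L[ℂ] TensorH E F) :=
  have key : ∀ (a : A) (x : E.mod) (h : F.H),
      tensorOp (E.ρ a) (E.left_mem a) (ContinuousLinearMap.id ℂ F.H) (tmulOp E F x h) =
        tmulOp E F ⟨E.ρ a ∘L (x : G →L[ℂ] E.H), E.left_mem a _ x.2⟩ h := fun a x h =>
    tensorOp_tmulOp (E.ρ a) (E.left_mem a) (ContinuousLinearMap.id ℂ F.H) (fun _ _ => rfl) x h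
  { toFun := fun a => tensorOp (E.ρ a) (E.left_mem a) (ContinuousLinearMap.id ℂ F.H)
    map_one' := tensorH_ext fun x h => by
      rw [key]
      exact congrArg (fun z => tmulOp E F z h) (Subtype.ext (by simp only [map_one]; rfl))
    map_mul' := fun a b => tensorH_ext fun x h => by
      rw [key, FunLike.coe_mul_eq_comp, Function.comp_apply, key, key]
      exact congrArg (fun z => tmulOp E F z h) (Subtype.ext (by simp only [map_mul]; rfl))
    map_zero' := tensorH_ext fun x h => by
      rw [key]
      have h1 : (⟨E.ρ 0 ∘L (x : G →L[ℂ] E.H), E.left_mem 0 _ x.2⟩ : E.mod) = (0 : ℂ) • x := by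
        refine Subtype.ext ?_
        simp
      rw [h1, tmulOp_smul]
      simp
    map_add' := fun a b => tensorH_ext fun x h => by
      rw [key, add_apply, key, key, ← add_apply, ← tmulOp_add]
      exact congrArg (fun z => tmulOp E F z h) (Subtype.ext (by simp))
    commutes' := fun c => tensorH_ext fun x h => by
      rw [key, Algebra.algebraMap_eq_smul_one, Algebra.algebraMap_eq_smul_one, smul_apply,
        one_apply_eq_self, ← smul_apply, ← tmulOp_smul]
      refine congrArg (fun z => tmulOp E F z h) (Subtype.ext ?_)
      simp only [map_smul, map_one]
      ext g
      simp
    map_star' := fun a => by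
      rw [star_eq_adjoint]
      refine tensorH_ext fun x h => tensorH_ext_inner fun y k => ?_
      rw [adjoint_inner_right, key, key, inner_tmulOp, inner_tmulOp]
      refine congrArg (fun b => ⟪k, F.ρ b h⟫_ℂ) (Subtype.ext ?_)
      simp only [PreBimodule.inn, map_star, star_eq_adjoint, adjoint_comp]
      rfl }

lemma tensorρ_tmulOp (E : PreBimodule A B) (F : PreBimodule B C) (a : A) (x : E.mod) (h : F.H) :
    tensorρ E F a (tmulOp E F x h) =
      tmulOp E F ⟨E.ρ a ∘L (x : G →L[ℂ] E.H), E.left_mem a _ x.2⟩ h :=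
  tensorOp_tmulOp (E.ρ a) (E.left_mem a) (ContinuousLinearMap.id ℂ F.H) (fun _ _ => rfl) x h

/-- The elementary tensor `x ⊙ y`, as the operator `k ↦ x ⊗ y k`. -/
def tmul (E : PreBimodule A B) (F : PreBimodule B C) (x : E.mod) (y : F.mod) :
    L →L[ℂ] TensorH E F :=
  tmulOp E F x ∘L (y : L →L[ℂ] F.H)

/-- The tensor product `E ⊙ F` of von Neumann modules: the strong closure of the linear span of the
elementary tensors `x ⊙ y`. -/
def Bimodule.tensor (E : Bimodule A B) (F : Bimodule B C) : Bimodule A C where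
  H := TensorH E.toPreBimodule F.toPreBimodule
  ρ := tensorρ E.toPreBimodule F.toPreBimodule
  mod := sotClosure (Submodule.span ℂ
    {z | ∃ (x : E.mod) (y : F.mod), tmul E.toPreBimodule F.toPreBimodule x y = z})
  right_mem z hz c := by
    refine sotClosure_map (ContinuousLinearMap.id ℂ _) (c : L →L[ℂ] L) (fun w hw => ?_) hz
    induction hw using Submodule.span_induction with
    | mem w hw =>
      obtain ⟨x, y, rfl⟩ := hw
      exact Submodule.subset_span ⟨x, ⟨_, F.right_mem y y.2 c⟩, rfl⟩
    | zero => simp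
    | add w w' _ _ hw hw' => simpa using add_mem hw hw'
    | smul c w _ hw => simpa using Submodule.smul_mem _ c hw
  left_mem a z hz := by
    refine sotClosure_map (tensorρ E.toPreBimodule F.toPreBimodule a)
      (ContinuousLinearMap.id ℂ L) (fun w hw => ?_) hz
    induction hw using Submodule.span_induction with
    | mem w hw =>
      obtain ⟨x, y, rfl⟩ := hw
      refine Submodule.subset_span ⟨⟨_, E.left_mem a x x.2⟩, y, ?_⟩
      exact ContinuousLinearMap.ext fun k =>
        (tensorρ_tmulOp E.toPreBimodule F.toPreBimodule a x _).symm
    | zero => simp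
    | add w w' _ _ hw hw' => simpa using add_mem hw hw'
    | smul c w _ hw => simpa using Submodule.smul_mem _ c hw
  inner_mem z hz w hw := by
    refine sotClosure_inner_mem C (fun z hz w hw => ?_) hz hw
    induction hz using Submodule.span_induction with
    | zero => simp
    | add z z' _ _ hz hz' => simpa [add_comp] using add_mem hz hz'
    | smul c z _ hz =>
      have h1 : adjoint (c • z) ∘L w = star c • (adjoint z ∘L w) := by
        rw [map_smulₛₗ, smul_comp]
        rfl
      rw [h1]
      exact SMulMemClass.smul_mem (star c) hz
    | mem z hz =>
    induction hw using Submodule.span_induction with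
    | zero => simp
    | add z z' _ _ hz hz' => simpa [comp_add] using add_mem hz hz'
    | smul c z _ hz => simpa [comp_smul] using SMulMemClass.smul_mem c hz
    | mem w hw =>
    obtain ⟨x, y, rfl⟩ := hz
    obtain ⟨x', y', rfl⟩ := hw
    have h1 : adjoint (tmul E.toPreBimodule F.toPreBimodule x y) ∘L
        tmul E.toPreBimodule F.toPreBimodule x' y' =
        adjoint (y : L →L[ℂ] F.H) ∘L (F.ρ (E.inn x x') ∘L (y' : L →L[ℂ] F.H)) := by
      ext k
      refine ext_inner_left ℂ fun k' => ?_
      simp only [comp_apply, adjoint_inner_right, tmul]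
      exact inner_tmulOp _ _ _ _ _ _
    rw [h1]
    exact F.inner_mem _ y.2 _ (F.left_mem _ _ y'.2)
  sotClosed := sotClosure_idem _
  total := by
    refine top_le_iff.mp ((tmulOp_dense E.toPreBimodule F.toPreBimodule).symm.le.trans ?_)
    refine Submodule.topologicalClosure_minimal _ ?_ (Submodule.isClosed_topologicalClosure _)
    rw [Submodule.span_le]
    rintro _ ⟨x, h, rfl⟩
    set P := (Submodule.span ℂ {h | ∃ z ∈ sotClosure (Submodule.span ℂ
      {z | ∃ (x : E.mod) (y : F.mod), tmul E.toPreBimodule F.toPreBimodule x y = z}),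
        ∃ g : L, z g = h}).topologicalClosure with hP
    have h1 : (⊤ : Submodule ℂ F.H) ≤ P.comap
        (tmulOp E.toPreBimodule F.toPreBimodule x : F.H →ₗ[ℂ] _) := by
      rw [← F.total]
      refine Submodule.topologicalClosure_minimal _ ?_
        ((Submodule.isClosed_topologicalClosure _).preimage
          (tmulOp E.toPreBimodule F.toPreBimodule x).continuous)
      rw [Submodule.span_le]
      rintro _ ⟨y, hy, k, rfl⟩
      exact Submodule.le_topologicalClosure _ (Submodule.subset_span
        ⟨_, le_sotClosure _ (Submodule.subset_span ⟨x, ⟨y, hy⟩, rfl⟩), k, rfl⟩)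
    exact h1 (Submodule.mem_top (x := h))

/-- The trivial `B`-`B`-module `B`. -/
def Bimodule.self (B : VonNeumannAlgebra G) : Bimodule B B where
  H := G
  ρ := StarSubalgebra.subtype B.toStarSubalgebra
  mod := Subalgebra.toSubmodule B.toStarSubalgebra.toSubalgebra
  right_mem x hx b := mul_mem (S := VonNeumannAlgebra G) (s := B) hx b.2
  left_mem a x hx := mul_mem (S := VonNeumannAlgebra G) (s := B) a.2 hx
  inner_mem x hx y hy :=
    mul_mem (S := VonNeumannAlgebra G) (s := B) (star_mem (s := B) hx) hy
  sotClosed x hx := by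
    change x ∈ B
    refine mem_of_comm B fun c hc => ?_
    have h := sotClosure_induction (fun f => ∀ g, c (f g) = f (c g)) ?_ ?_ hx
    · ext g
      exact h g
    · simp only [Set.ofPred_forall]
      exact isClosed_iInter fun g => isClosed_eq (by fun_prop) (by fun_prop)
    · intro b hb g
      exact (congrArg (fun T : G →L[ℂ] G => T g) (hc b hb)).symm
  total := by
    rw [Submodule.eq_top_iff']
    exact fun g => Submodule.le_topologicalClosure _ (Submodule.subset_span
      ⟨1, one_mem B, g, rfl⟩)

end TensorBimodule

section InclusionSystems

variable {K G L : Type u}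
  [NormedAddCommGroup K] [InnerProductSpace ℂ K] [CompleteSpace K]
  [NormedAddCommGroup G] [InnerProductSpace ℂ G] [CompleteSpace G]
  [NormedAddCommGroup L] [InnerProductSpace ℂ L] [CompleteSpace L]
  {A : VonNeumannAlgebra K} {B : VonNeumannAlgebra G} {C : VonNeumannAlgebra L}

/-- An adjointable bilinear map `E → F` of von Neumann modules. It is given by the operator
`op : E.H → F.H`, `x g ↦ (T x) g`: the map itself is `x ↦ op ∘ x`, its adjoint is `y ↦ op* ∘ y`,
and its norm is the norm of `op`. Right linearity is automatic. -/
@[ext]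
structure Hom (E F : Bimodule A B) where
  /-- the operator inducing the map -/
  op : E.H →L[ℂ] F.H
  map_mem : ∀ x ∈ E.mod, op ∘L x ∈ F.mod
  adjoint_map_mem : ∀ y ∈ F.mod, adjoint op ∘L y ∈ E.mod
  intertwines : ∀ (a : A) (h : E.H), op (E.ρ a h) = F.ρ a (op h)

namespace Hom

/-- The identity map. -/
def id (E : Bimodule A B) : Hom E E where
  op := ContinuousLinearMap.id ℂ E.H
  map_mem _ hx := hx
  adjoint_map_mem y hy := by
    have h : adjoint (ContinuousLinearMap.id ℂ E.H) = ContinuousLinearMap.id ℂ E.H := adjoint_id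
    rw [h]
    exact hy
  intertwines _ _ := rfl

/-- The map is a bilinear isometry. -/
def IsIsometry {E F : Bimodule A B} (T : Hom E F) : Prop :=
  ∀ h : E.H, ‖T.op h‖ = ‖h‖

/-- The map is a bilinear unitary. -/
def IsUnitary {E F : Bimodule A B} (T : Hom E F) : Prop :=
  T.IsIsometry ∧ Function.Surjective T.op

/-- The operator `x ⊗ h ↦ T x ⊗ S h` which induces the map `T ⊙ S`, `x ⊙ y ↦ T x ⊙ S y`. -/
def tensorOp {E E' : Bimodule A B} {F F' : Bimodule B C} (T : Hom E E') (S : Hom F F') :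
    (E.tensor F).H →L[ℂ] (E'.tensor F').H :=
  VNMod.tensorOp T.op T.map_mem S.op

lemma tensorOp_tmulOp {E E' : Bimodule A B} {F F' : Bimodule B C} (T : Hom E E') (S : Hom F F')
    (x : E.mod) (h : F.H) :
    T.tensorOp S (tmulOp E.toPreBimodule F.toPreBimodule x h) =
      tmulOp E'.toPreBimodule F'.toPreBimodule ⟨_, T.map_mem x x.2⟩ (S.op h) :=
  VNMod.tensorOp_tmulOp T.op T.map_mem S.op S.intertwines x h

end Hom

/-- The elementary tensor `x ⊙ y` as an element of `E ⊙ F`. -/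
def Bimodule.tmul (E : Bimodule A B) (F : Bimodule B C) (x : E.mod) (y : F.mod) :
    (E.tensor F).mod :=
  ⟨VNMod.tmul E.toPreBimodule F.toPreBimodule x y,
    le_sotClosure _ (Submodule.subset_span ⟨x, y, rfl⟩)⟩

/-- The vector `x ⊗ h` of the Hilbert space of `E ⊙ F`. -/
def Bimodule.tvec (E : Bimodule A B) (F : Bimodule B C) (x : E.mod) (h : F.H) :
    (E.tensor F).H :=
  tmulOp E.toPreBimodule F.toPreBimodule x h

/-- An inclusion system `(E, β)` of von Neumann `B`-`B`-modules indexed by `ℝ≥0`. The identification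
`E₀ = B` is recorded as a bilinear unitary. The map `β s t r h : E_r → E_s ⊙ E_t`, where
`h : s + t = r`, is `β_{s,t}`. The equation
`(β_{r,s} ⊙ id) β_{r+s,t} = (id ⊙ β_{s,t}) β_{r,s+t}` uses the identification of
`(x ⊙ y) ⊙ z` with `x ⊙ (y ⊙ z)`; it is expressed by equality of the inner products of both sides
with the total sets of corresponding vectors `(x ⊙ y) ⊗ k` and `x ⊗ (y ⊗ k)`. -/
structure InclusionSystem (E : ℝ≥0 → Bimodule B B) where
  normal : ∀ t, (E t).IsNormal
  zero : Hom (E 0) (Bimodule.self B)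
  zero_unitary : zero.IsUnitary
  β : ∀ s t r : ℝ≥0, s + t = r → Hom (E r) ((E s).tensor (E t))
  isometry : ∀ s t r h, (β s t r h).IsIsometry
  coassoc : ∀ (r s t u v w : ℝ≥0) (hu : r + s = u) (hv : s + t = v) (hw : u + t = w)
    (hw' : r + v = w) (x : (E r).mod) (y : (E s).mod) (k : (E t).H) (z : (E w).H),
    ⟪((E r).tensor (E s)).tvec (E t) ((E r).tmul (E s) x y) k,
      (β r s u hu).tensorOp (Hom.id (E t)) ((β u t w hw).op z)⟫_ℂ =
    ⟪(E r).tvec ((E s).tensor (E t)) x ((E s).tvec (E t) y k),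
      (Hom.id (E r)).tensorOp (β s t v hv) ((β r v w hw').op z)⟫_ℂ

/-- `(E, β, ξ)` is the inclusion system associated to the family `φ` of maps on `B`: each `(E_t, ξ_t)`
is the minimal GNS-module of `φ_t` (that is, `φ_t(a) = ⟨ξ_t, a ξ_t⟩`, and the strong closure of the
linear span of `B ξ_t B` is all of `E_t`), `β_{s,t}` maps `ξ_{s+t}` to `ξ_s ⊙ ξ_t`, and `ξ_0`
corresponds to `1` under the identification `E_0 = B`. -/
structure IsAssociated {E : ℝ≥0 → Bimodule B B} (S : InclusionSystem E) (ξ : ∀ t, (E t).mod)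
    (φ : ℝ≥0 → B → B) : Prop where
  gns : ∀ t a, adjoint (ξ t : G →L[ℂ] (E t).H) ∘L (E t).ρ a ∘L (ξ t : G →L[ℂ] (E t).H) =
    (φ t a : G →L[ℂ] G)
  cyclic : ∀ t, (E t).mod ≤ sotClosure (Submodule.span ℂ
    {y | ∃ a b : B, y = (E t).ρ a ∘L (ξ t : G →L[ℂ] (E t).H) ∘L (b : G →L[ℂ] G)})
  unit : ∀ s t r h, (S.β s t r h).op ∘L (ξ r : G →L[ℂ] (E r).H) =
    ((E s).tmul (E t) (ξ s) (ξ t) : G →L[ℂ] ((E s).tensor (E t)).H)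
  zero : S.zero.op ∘L (ξ 0 : G →L[ℂ] (E 0).H) = ContinuousLinearMap.id ℂ G

/-- `T = (T_t)` is a (weak) morphism from `(E, β)` to `(F, γ)`: `‖T_t‖ ≤ e^{tk}` for some `k`, and
`T_{s+t} = γ_{s,t}* (T_s ⊙ T_t) β_{s,t}`. -/
def IsWeakMorphism {E F : ℝ≥0 → Bimodule B B} (S : InclusionSystem E) (S' : InclusionSystem F)
    (T : ∀ t, Hom (E t) (F t)) : Prop :=
  (∃ k : ℝ, ∀ t : ℝ≥0, ‖(T t).op‖ ≤ Real.exp (t * k)) ∧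
  ∀ (s t r : ℝ≥0) (h : s + t = r), (T r).op =
    adjoint (S'.β s t r h).op ∘L (T s).tensorOp (T t) ∘L (S.β s t r h).op

/-- The vector `𝔼ᵢᵢ η 𝔼ᵢᵢ`. -/
def cornerVec (E : Bimodule (M2 B) (M2 B)) (i : Fin 2) (η : E.mod) : E.mod :=
  ⟨E.ρ (M2.unit B i i) ∘L (η : Sq G →L[ℂ] E.H) ∘L (M2.unit B i i : Sq G →L[ℂ] Sq G),
    E.left_mem _ _ (E.right_mem _ η.2 _)⟩

/-- The `B`-`B`-module `(𝔼ᵢᵢ E)^(B)`. -/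
def cornerModule (E : Bimodule (M2 B) (M2 B)) (i : Fin 2) : PreBimodule B B :=
  (E.toPreBimodule.corner i).collapse

/-- The class `[𝔼ᵢᵢ η 𝔼ᵢᵢ]` in `(𝔼ᵢᵢ E)^(B)`. -/
def cornerClass (E : Bimodule (M2 B) (M2 B)) (i : Fin 2) (η : E.mod) : (cornerModule E i).mod :=
  ⟨(cornerVec E i η : Sq G →L[ℂ] E.H) ∘L dbl G,
    ⟨_, ⟨_, E.right_mem _ η.2 (M2.unit B i i), rfl⟩, rfl⟩⟩

/-- The strong closure of the linear span of `B ξ B` in `(𝔼ᵢᵢ E)^(B)`, where `ξ = [𝔼ᵢᵢ η 𝔼ᵢᵢ]`. -/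
def diagModule (E : Bimodule (M2 B) (M2 B)) (i : Fin 2) (η : E.mod) : Bimodule B B :=
  ((cornerModule E i).cyclicSub (cornerClass E i η).2).essential

/-- The vector `ξ = [𝔼ᵢᵢ η 𝔼ᵢᵢ]` of `diagModule E i η`. -/
def diagVec (E : Bimodule (M2 B) (M2 B)) (i : Fin 2) (η : E.mod) : (diagModule E i η).mod :=
  ((cornerModule E i).cyclicSub (cornerClass E i η).2).essentialVec
    ((cornerModule E i).mem_cyclicSub (cornerClass E i η).2)

end InclusionSystems

end VNMod

end

open VNMod

/-! Everything rests on GNS-modules. A normal completely positive map `Φ` has a cyclic module `E`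
with a vector `η` such that `Φ a = ⟨η, a η⟩` (`exists_gns`, a Kolmogorov construction for the kernel
`Φ (star a * b)`). Because `E` is cyclic, a bilinear isometry out of it exists as soon as the target
has a vector with the same moments (`Bimodule.IsCyclic.exists_hom`). In `E_s ⊙ E_t` the vector `ξ_s
⊙ ξ_t` has moments `φ_t (φ_s a) = φ_{s+t} a`. This gives `β_{s,t}`, and coassociativity need only be
compared on generators. Hence any family of GNS-modules of a normal semigroup is an inclusion system
(`exists_inclusionSystem`). The theorem uses this three times: for `Φ` and for each `φ i`.

The block form of `Φ` makes the `i`-th diagonal entry of `⟨η, 𝔼ⱼⱼ η⟩` vanish for `j ≠ i`, so `𝔼ⱼⱼ η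
𝔼ᵢᵢ = 0` and `η` commutes with the diagonal matrix units (`ρ_unit_comp`). Statement 1 follows by
moving `𝔼ᵢᵢ` through `η_s ⊙ η_t`. The class `ξ^i` is then the `i`-th column `η ∘ inj i`, and its
moments are the `i`-th diagonal entries of those of `η` at `diag(a, a)`, that is, `φ i`. This gives
statement 2.

For statement 3 the morphism is the compression of `𝔼₁₂` to the two diagonal modules (`diagHom`). It
is contractive because the matrix unit is, and its matrix element between `ξ^1` and `a ξ^2` is the
off-diagonal entry of `Φ`, which is `ψ`. That the compression takes values in the module, and that
it is adjointable, both come from self-duality of von Neumann modules (`Bimodule.mem_of_inner_mem`).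
A bilinear map between cyclic modules is determined by the function `a ↦ ⟨ζ, T a ξ⟩`. This yields
uniqueness (`Hom.ext_of_cyclic`), and together with the semigroup law of `ψ` it yields the morphism
relation (`op_eq_of_semigroup`).

Normality of the modules is a separate matter: suprema of directed sets are described through vector
functionals, and normality is carried from the map to its GNS-module by
`Bimodule.isNormal_of_cyclic`. -/

noncomputable section

namespace VNMod

/-! ### Self-duality of von Neumann modules -/

section SelfDual

variable {K G : Type u} [NormedAddCommGroup K] [InnerProductSpace ℂ K] [CompleteSpace K]
  [NormedAddCommGroup G] [InnerProductSpace ℂ G] [CompleteSpace G]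
  {A : VonNeumannAlgebra K} {B : VonNeumannAlgebra G}

/-- A bounded net of operators which tends to zero strongly on a total set tends to zero
strongly. -/
lemma tendsto_apply_zero_of_total {ι H H' : Type*} [NormedAddCommGroup H] [InnerProductSpace ℂ H]
    [NormedAddCommGroup H'] [InnerProductSpace ℂ H'] {l : Filter ι} {T : ι → H →L[ℂ] H'} {C : ℝ}
    (hC : ∀ᶠ i in l, ∀ h, ‖T i h‖ ≤ C * ‖h‖) {s : Set H}
    (hs : (Submodule.span ℂ s).topologicalClosure = ⊤)
    (hT : ∀ h ∈ s, Filter.Tendsto (fun i => T i h) l (nhds 0)) (h : H) :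
    Filter.Tendsto (fun i => T i h) l (nhds 0) := by
  have hd : h ∈ closure (Submodule.span ℂ s : Set H) := hs.ge (Submodule.mem_top (x := h))
  rw [Metric.tendsto_nhds]
  intro ε hε
  obtain ⟨k, hk, hhk⟩ := Metric.mem_closure_iff.mp hd (ε / (2 * (|C| + 1))) (by positivity)
  have hk' : Filter.Tendsto (fun i => T i k) l (nhds 0) := by
    clear hhk
    induction hk using Submodule.span_induction with
    | mem k hk => exact hT k hk
    | zero => simpa using tendsto_const_nhds
    | add k k' _ _ hk hk' => simpa using hk.add hk'
    | smul c k _ hk => simpa using hk.const_smul c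
  filter_upwards [Metric.tendsto_nhds.mp hk' (ε / 2) (by positivity), hC] with i hi hCi
  rw [dist_zero_right] at hi ⊢
  rw [dist_eq_norm, lt_div_iff₀ (by positivity)] at hhk
  have h1 : ‖T i (h - k)‖ ≤ (|C| + 1) * ‖h - k‖ :=
    (hCi _).trans (mul_le_mul_of_nonneg_right (by linarith [le_abs_self C]) (norm_nonneg _))
  have h2 : ‖T i h‖ ≤ ‖T i (h - k)‖ + ‖T i k‖ := by
    have := norm_add_le (T i (h - k)) (T i k)
    rwa [← map_add, sub_add_cancel] at this
  linarith

lemma isClosed_of_sotClosure_le {G H : Type*} [NormedAddCommGroup G] [InnerProductSpace ℂ G]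
    [NormedAddCommGroup H] [InnerProductSpace ℂ H]
    {S : Submodule ℂ (G →L[ℂ] H)} (h : sotClosure S ≤ S) : IsClosed (S : Set (G →L[ℂ] H)) := by
  have hc : Continuous fun y : G →L[ℂ] H => (y : G → H) :=
    continuous_pi fun g => (ContinuousLinearMap.apply ℂ H g).continuous
  refine isClosed_of_closure_subset fun x hx => h (mem_sotClosure.mpr ?_)
  exact map_mem_closure hc hx fun y hy => ⟨y, hy, rfl⟩

/-- The closed *-algebra generated by the rank-one operators `y z*` of a module. -/
def compactOps (E : PreBimodule A B) : NonUnitalStarSubalgebra ℂ (E.H →L[ℂ] E.H) :=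
  (NonUnitalStarAlgebra.adjoin ℂ
    {T | ∃ y ∈ E.mod, ∃ z ∈ E.mod, T = y ∘L adjoint z}).topologicalClosure

instance (E : PreBimodule A B) : IsClosed (compactOps E : Set (E.H →L[ℂ] E.H)) :=
  isClosed_closure

lemma PreBimodule.inner_mem_of_mem (E : PreBimodule A B) {x : G →L[ℂ] E.H} (hx : x ∈ E.mod) :
    ∀ z ∈ E.mod, adjoint z ∘L x ∈ B := fun z hz => E.inner_mem z hz x hx

/-- For a generator, `(y z*) x = y (z* x)` lies in `E B ⊆ E`. Only `z* x ∈ B` is needed of `x`, so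
compact operators push even a vector not known to lie in `E` into `E`; this is what the proof of
self-duality exploits. -/
lemma compactOps_comp_mem (E : PreBimodule A B) {x : G →L[ℂ] E.H}
    (hx : ∀ z ∈ E.mod, adjoint z ∘L x ∈ B) {T : E.H →L[ℂ] E.H} (hT : T ∈ compactOps E) :
    T ∘L x ∈ E.mod := by
  have hc : Continuous fun T : E.H →L[ℂ] E.H => T ∘L x :=
    continuous_id.clm_comp continuous_const
  have hcl := isClosed_of_sotClosure_le E.sotClosed
  have halg : ∀ T ∈ NonUnitalStarAlgebra.adjoin ℂ
      {T | ∃ y ∈ E.mod, ∃ z ∈ E.mod, T = y ∘L adjoint z},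
      ∀ x : G →L[ℂ] E.H, (∀ z ∈ E.mod, adjoint z ∘L x ∈ B) → T ∘L x ∈ E.mod := by
    intro T hT
    change T ∈ NonUnitalAlgebra.adjoin ℂ _ at hT
    induction hT using NonUnitalAlgebra.adjoin_induction with
    | mem T hT =>
      intro x hx
      have key : ∀ y ∈ E.mod, ∀ z ∈ E.mod, (y ∘L adjoint z) ∘L x ∈ E.mod := fun y hy z hz =>
        E.right_mem y hy ⟨_, hx z hz⟩
      rcases hT with ⟨y, hy, z, hz, rfl⟩ | ⟨y, hy, z, hz, h⟩
      · exact key y hy z hz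
      · have h1 : T = z ∘L adjoint y := by
          rw [← star_star T, h, star_eq_adjoint, adjoint_comp, adjoint_adjoint]
        rw [h1]
        exact key z hz y hy
    | add S T _ _ hS hT =>
      intro x hx
      rw [add_comp]
      exact add_mem (hS x hx) (hT x hx)
    | zero =>
      intro x _
      rw [zero_comp]
      exact zero_mem _
    | mul S T _ _ hS hT =>
      intro x hx
      -- The induction runs over all `x` at once, since here `S` is applied to the vector `T x`.
      exact hS _ (E.inner_mem_of_mem (hT x hx))
    | smul c T _ hT =>
      intro x hx
      rw [smul_comp]
      exact E.mod.smul_mem c (hT x hx)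
  have := map_mem_closure (f := fun T : E.H →L[ℂ] E.H => T ∘L x) (t := E.mod) hc hT
    fun T hT => halg T hT x hx
  exact hcl.closure_subset this

/-- Von Neumann modules are self-dual. -/
lemma Bimodule.mem_of_inner_mem (E : Bimodule A B) {x : G →L[ℂ] E.H}
    (hx : ∀ z ∈ E.mod, adjoint z ∘L x ∈ B) : x ∈ E.mod := by
  -- An approximate unit of the C*-algebra of compact operators converges strongly to `1`. Thus `x`
  -- is the strong limit of the vectors `T x`, which lie in `E`.
  let R := compactOps E.toPreBimodule
  let _ : PartialOrder R := CStarAlgebra.spectralOrder R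
  have : StarOrderedRing R := CStarAlgebra.spectralOrderedRing R
  have hl := CStarAlgebra.increasingApproximateUnit R
  have := hl.toIsApproximateUnit.neBot
  set l := CStarAlgebra.approximateUnit R
  have h1 : ∀ z ∈ E.mod, ∀ g : G, Filter.Tendsto (fun T : R => ((T : E.H →L[ℂ] E.H) - 1) (z g)) l
      (nhds 0) := by
    intro z hz g
    have hm : z ∘L adjoint z ∈ R :=
      NonUnitalStarSubalgebra.le_topologicalClosure _
        (NonUnitalStarAlgebra.subset_adjoin ℂ _ ⟨z, hz, z, hz, rfl⟩)
    -- By the C*-identity the left side is the norm of `(T z z* - z z*)(T* - 1)`, and the second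
    -- factor has norm at most `2`.
    have h2 : ∀ᶠ T : R in l, ‖(T : E.H →L[ℂ] E.H) ∘L z - z‖ ^ 2 ≤
        2 * ‖T * ⟨_, hm⟩ - (⟨_, hm⟩ : R)‖ := by
      filter_upwards [hl.eventually_norm] with T hT
      have h3 : ((T : E.H →L[ℂ] E.H) ∘L z - z) ∘L adjoint ((T : E.H →L[ℂ] E.H) ∘L z - z) =
          ((T * ⟨_, hm⟩ - (⟨_, hm⟩ : R) : R) : E.H →L[ℂ] E.H) ∘L
            (adjoint (T : E.H →L[ℂ] E.H) - 1) := by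
        rw [map_sub, adjoint_comp]
        ext h
        simp
      have h4 : ‖(T : E.H →L[ℂ] E.H) ∘L z - z‖ ^ 2 =
          ‖((T : E.H →L[ℂ] E.H) ∘L z - z) ∘L adjoint ((T : E.H →L[ℂ] E.H) ∘L z - z)‖ := by
        have := norm_adjoint_comp_self (adjoint ((T : E.H →L[ℂ] E.H) ∘L z - z))
        rw [adjoint_adjoint, LinearIsometryEquiv.norm_map] at this
        rw [this, sq]
      rw [h4, h3, mul_comm]
      refine (opNorm_comp_le _ _).trans (mul_le_mul_of_nonneg_left ?_ (norm_nonneg _))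
      refine (norm_sub_le _ _).trans ?_
      rw [LinearIsometryEquiv.norm_map]
      have h5 : ‖(T : E.H →L[ℂ] E.H)‖ ≤ 1 := hT
      have h6 : ‖(1 : E.H →L[ℂ] E.H)‖ ≤ 1 := norm_id_le
      linarith
    have h7 : Filter.Tendsto (fun T : R => 2 * ‖T * ⟨_, hm⟩ - (⟨_, hm⟩ : R)‖) l (nhds 0) := by
      have := (hl.tendsto_mul_right (⟨_, hm⟩ : R)).sub_const (⟨_, hm⟩ : R)
      simpa using this.norm.const_mul 2
    have h8 : Filter.Tendsto (fun T : R => ‖(T : E.H →L[ℂ] E.H) ∘L z - z‖ ^ 2) l (nhds 0) :=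
      squeeze_zero' (Filter.Eventually.of_forall fun _ => sq_nonneg _) h2 h7
    have h9 : Filter.Tendsto (fun T : R => ‖(T : E.H →L[ℂ] E.H) ∘L z - z‖) l (nhds 0) := by
      have := h8.sqrt
      simpa [Real.sqrt_sq (norm_nonneg _)] using this
    rw [tendsto_zero_iff_norm_tendsto_zero]
    refine squeeze_zero (fun _ => norm_nonneg _) (fun T => ?_)
      (by simpa using h9.mul_const ‖g‖)
    exact ((T : E.H →L[ℂ] E.H) ∘L z - z).le_opNorm g
  -- Convergence on the total vectors `z g` extends to all of `H` because `T - 1` is bounded by `2`.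
  have h2 : ∀ h : E.H, Filter.Tendsto (fun T : R => (T : E.H →L[ℂ] E.H) h) l (nhds h) := by
    intro h
    have h3 := tendsto_apply_zero_of_total (l := l) (C := 2)
      (T := fun T : R => (T : E.H →L[ℂ] E.H) - 1) ?_ E.total ?_ h
    · simpa using h3.add_const h
    · filter_upwards [hl.eventually_norm] with T hT h
      have h5 : ‖(T : E.H →L[ℂ] E.H)‖ ≤ 1 := hT
      have h6 := (T : E.H →L[ℂ] E.H).le_of_opNorm_le h5 h
      have h7 := norm_sub_le ((T : E.H →L[ℂ] E.H) h) h
      change ‖(T : E.H →L[ℂ] E.H) h - h‖ ≤ _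
      linarith
    · rintro _ ⟨z, hz, g, rfl⟩
      exact h1 z hz g
  refine E.sotClosed (mem_sotClosure.mpr ?_)
  refine mem_closure_of_tendsto (b := l) (f := fun T : R => fun g => (T : E.H →L[ℂ] E.H) (x g))
    (tendsto_pi_nhds.mpr fun g => h2 (x g)) (Filter.Eventually.of_forall fun T => ?_)
  exact ⟨_, compactOps_comp_mem E.toPreBimodule hx T.2, rfl⟩

/-- A bounded intertwiner which maps `E` into `F` is adjointable. -/
def Hom.mk' {E F : Bimodule A B} (op : E.H →L[ℂ] F.H) (map_mem : ∀ x ∈ E.mod, op ∘L x ∈ F.mod)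
    (intertwines : ∀ (a : A) (h : E.H), op (E.ρ a h) = F.ρ a (op h)) : Hom E F where
  op := op
  map_mem := map_mem
  adjoint_map_mem y hy := E.mem_of_inner_mem fun z hz => by
    have h := F.inner_mem _ (map_mem z hz) y hy
    rwa [adjoint_comp, comp_assoc] at h
  intertwines := intertwines

end SelfDual

/-! ### Normality through vector functionals -/

section Normality

open Filter Topology
open scoped ComplexOrder

variable {K G : Type u} [NormedAddCommGroup K] [InnerProductSpace ℂ K] [CompleteSpace K]
  [NormedAddCommGroup G] [InnerProductSpace ℂ G] [CompleteSpace G]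
  {A : VonNeumannAlgebra K} {B : VonNeumannAlgebra G}

lemma isPositive_of_inner_nonneg {H : Type*} [NormedAddCommGroup H] [InnerProductSpace ℂ H]
    {T : H →L[ℂ] H} (h : ∀ x, 0 ≤ ⟪T x, x⟫_ℂ) : T.IsPositive := by
  rw [isPositive_iff_complex]
  intro x
  have := Complex.nonneg_iff.mp (h x)
  exact ⟨Complex.ext rfl this.2, this.1⟩

lemma inner_sub_nonneg {H : Type*} [NormedAddCommGroup H] [InnerProductSpace ℂ H]
    {S T : H →L[ℂ] H} (h : S ≤ T) (x : H) : 0 ≤ ⟪(T - S) x, x⟫_ℂ :=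
  ((isPositive_iff _).mp (ContinuousLinearMap.le_def S T |>.mp h)).2 x

/-- Bounded nets of operators converge weakly along ultrafilters. -/
lemma exists_weak_limit {ι : Type*} (U : Ultrafilter ι) (T : ι → G →L[ℂ] G) (C : ℝ)
    (hT : ∀ᶠ i in (U : Filter ι), ‖T i‖ ≤ C) :
    ∃ y : G →L[ℂ] G, ∀ g k, Tendsto (fun i => ⟪T i g, k⟫_ℂ) U (𝓝 ⟪y g, k⟫_ℂ) := by
  have hbd : ∀ g k, ∀ᶠ i in (U : Filter ι),
      ⟪T i g, k⟫_ℂ ∈ Metric.closedBall 0 (C * ‖g‖ * ‖k‖) := by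
    intro g k
    filter_upwards [hT] with i hi
    rw [mem_closedBall_zero_iff]
    exact (norm_inner_le_norm _ _).trans
      (mul_le_mul_of_nonneg_right ((T i).le_of_opNorm_le hi g) (norm_nonneg k))
  have hlim : ∀ g k, ∃ z ∈ Metric.closedBall (0 : ℂ) (C * ‖g‖ * ‖k‖),
      Tendsto (fun i => ⟪T i g, k⟫_ℂ) U (𝓝 z) := fun g k =>
    (isCompact_closedBall (0 : ℂ) _).ultrafilter_le_nhds (U.map fun i => ⟪T i g, k⟫_ℂ)
      (le_principal_iff.mpr (hbd g k))
  choose b hb hlim using hlim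
  -- Compactness of closed discs gives each limit; uniqueness of limits makes the limit form
  -- sesquilinear, and the radii bound it by `C`.
  let L : G →ₗ⋆[ℂ] G →ₗ[ℂ] ℂ := LinearMap.mk₂'ₛₗ (starRingEnd ℂ) (RingHom.id ℂ) b
    (fun g g' k => tendsto_nhds_unique (hlim _ _)
      (by simpa [inner_add_left] using (hlim g k).add (hlim g' k)))
    (fun c g k => tendsto_nhds_unique (hlim _ _)
      (by simpa [inner_smul_left, mul_comm] using (hlim g k).const_mul (starRingEnd ℂ c)))
    (fun g k k' => tendsto_nhds_unique (hlim _ _)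
      (by simpa [inner_add_right] using (hlim g k).add (hlim g k')))
    (fun c g k => tendsto_nhds_unique (hlim _ _)
      (by simpa [inner_smul_right] using (hlim g k).const_mul c))
  refine ⟨InnerProductSpace.continuousLinearMapOfBilin (L.mkContinuous₂ C fun g k => ?_),
    fun g k => ?_⟩
  · exact mem_closedBall_zero_iff.mp (hb g k)
  · rw [InnerProductSpace.continuousLinearMapOfBilin_apply]
    exact hlim g k

/-- The least upper bound of a directed set in a von Neumann algebra is a weak limit point. -/
lemma exists_inner_lt_of_isLUB {d : Set B} (hne : d.Nonempty) (hdir : DirectedOn (· ≤ ·) d) {a : B}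
    (ha : IsLUB d a) (h : G) {ε : ℝ} (hε : 0 < ε) :
    ∃ x ∈ d, (⟪((a : G →L[ℂ] G) - x) h, h⟫_ℂ).re < ε := by
  obtain ⟨x₀, hx₀⟩ := hne
  have : Nonempty d := ⟨⟨x₀, hx₀⟩⟩
  have : IsDirectedOrder d := directedOn_iff_isDirectedOrder.mp hdir
  let U : Ultrafilter d := Ultrafilter.of atTop
  have hge : ∀ x : d, ∀ᶠ x' : d in (U : Filter d), x ≤ x' := fun x =>
    Ultrafilter.of_le atTop (eventually_ge_atTop x)
  -- The gaps `a - x` decrease, so beyond `x₀` their norms are at most that of `a - x₀`. Their weak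
  -- limit `y` lies in `B` and below every gap, so `a - y` is an upper bound of `d` in `B`.
  -- Leastness of `a` gives `y ≤ 0`, and hence gaps that are small at `h`.
  obtain ⟨c, hc⟩ : ∃ c : d → G →L[ℂ] G, ∀ x, c x = (a : G →L[ℂ] G) - ((x : B) : G →L[ℂ] G) :=
    ⟨_, fun _ => rfl⟩
  have hcB : ∀ x, c x ∈ B := fun x => hc x ▸ sub_mem a.2 (x : B).2
  have hanti : ∀ x x' : d, x ≤ x' → c x' ≤ c x := fun x x' hxx => by
    rw [hc, hc]
    exact sub_le_sub_left (show ((x : B) : G →L[ℂ] G) ≤ (x' : B) from hxx) _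
  have hnn : ∀ x : d, 0 ≤ c x := fun x => by
    rw [hc]
    exact sub_nonneg.mpr (show ((x : B) : G →L[ℂ] G) ≤ a from ha.1 x.2)
  obtain ⟨y, hy⟩ := exists_weak_limit U c ‖c ⟨x₀, hx₀⟩‖ <| by
    filter_upwards [hge ⟨x₀, hx₀⟩] with x hx
    exact CStarAlgebra.norm_le_norm_of_nonneg_of_le (hnn x) (hanti _ _ hx)
  have hyB : y ∈ B := by
    refine mem_of_comm B fun b hb => ?_
    ext g
    refine ext_inner_right ℂ fun k => ?_
    have h1 := hy g (adjoint b k)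
    have h2 := hy (b g) k
    rw [adjoint_inner_right] at h1
    refine tendsto_nhds_unique (h1.congr fun x => ?_) h2
    rw [adjoint_inner_right]
    exact congrArg (fun T : G →L[ℂ] G => ⟪T g, k⟫_ℂ) (hb _ (hcB x)).symm
  have hle : ∀ x : d, y ≤ c x := by
    intro x
    rw [ContinuousLinearMap.le_def]
    refine isPositive_of_inner_nonneg fun g => ?_
    have h1 : Tendsto (fun x' : d => ⟪c x g, g⟫_ℂ - ⟪c x' g, g⟫_ℂ) U (𝓝 ⟪(c x - y) g, g⟫_ℂ) := by
      rw [sub_apply, inner_sub_left]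
      exact (hy g g).const_sub _
    refine ge_of_tendsto h1 ?_
    filter_upwards [hge x] with x' hx'
    rw [← inner_sub_left, ← sub_apply]
    exact inner_sub_nonneg (hanti _ _ hx') g
  have hub : a ≤ a - ⟨y, hyB⟩ := ha.2 fun x hx => by
    have h1 := hle ⟨x, hx⟩
    rw [hc] at h1
    exact le_sub_comm.mp h1
  have hneg : 0 ≤ ⟪(-y) h, h⟫_ℂ := by
    have h1 : (a : G →L[ℂ] G) ≤ a - y := hub
    have h2 := inner_sub_nonneg h1 h
    rwa [sub_sub_cancel_left] at h2
  have hneg' : (⟪y h, h⟫_ℂ).re < ε := by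
    have := (Complex.nonneg_iff.mp hneg).1
    rw [neg_apply, inner_neg_left, Complex.neg_re] at this
    linarith
  obtain ⟨x, hx⟩ :=
    (((Complex.continuous_re.tendsto _).comp (hy h h)).eventually_lt_const hneg').exists
  refine ⟨x, x.2, ?_⟩
  rw [← hc]
  exact hx

/-- For an upper bound `z`, write `z - a = (z - x) - (a - x)`: at `h` the first term is nonnegative
and the second can be made smaller than any `ε`. It is the converse of `exists_inner_lt_of_isLUB`.
-/
lemma isLUB_of_exists_inner_lt {H : Type*} [NormedAddCommGroup H] [InnerProductSpace ℂ H]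
    [CompleteSpace H] {d : Set (H →L[ℂ] H)} {a : H →L[ℂ] H} (ha : ∀ x ∈ d, x ≤ a)
    (hlt : ∀ h, ∀ ε > 0, ∃ x ∈ d, (⟪(a - x) h, h⟫_ℂ).re < ε) : IsLUB d a := by
  refine ⟨ha, fun z hz => (ContinuousLinearMap.le_def _ _).mpr (isPositive_of_inner_nonneg fun h => ?_)⟩
  have key : ∀ x, ⟪(z - a) h, h⟫_ℂ = ⟪(z - x) h, h⟫_ℂ - ⟪(a - x) h, h⟫_ℂ := fun x => by
    rw [← inner_sub_left, ← sub_apply]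
    congr 2
    abel
  rw [Complex.nonneg_iff]
  constructor
  · refine le_of_forall_pos_sub_le fun ε hε => ?_
    obtain ⟨x, hx, hlt⟩ := hlt h ε hε
    rw [key x, Complex.sub_re]
    have := (Complex.nonneg_iff.mp (inner_sub_nonneg (hz hx) h)).1
    linarith
  · obtain ⟨x, hx, -⟩ := hlt h 1 one_pos
    rw [key x, Complex.sub_im, ← (Complex.nonneg_iff.mp (inner_sub_nonneg (hz hx) h)).2,
      ← (Complex.nonneg_iff.mp (inner_sub_nonneg (ha x hx) h)).2, sub_zero]

/-- A monotone map between von Neumann algebras is normal if, for every vector `h`, the function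
`x ↦ ⟪f x h, h⟫` is a sum of functions `x ↦ ⟪x g, g⟫`. -/
lemma scottContinuous_of_inner_eq {f : A → B} (hf : Monotone f) {n : Type*} [Fintype n]
    (v : n → G → K) (h : ∀ x h, ⟪(f x : G →L[ℂ] G) h, h⟫_ℂ =
      ∑ i, ⟪(x : K →L[ℂ] K) (v i h), v i h⟫_ℂ) : ScottContinuous f := by
  classical
  intro d hne hdir a ha
  have h1 : IsLUB ((fun x : B => (x : G →L[ℂ] G)) '' (f '' d)) (f a : G →L[ℂ] G) := by
    refine isLUB_of_exists_inner_lt ?_ fun g ε hε => ?_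
    · rintro _ ⟨_, ⟨x, hx, rfl⟩, rfl⟩
      exact hf (ha.1 hx)
    -- Each vector functional gives its own approximating element of `d`; directedness provides a
    -- common one for finitely many.
    · have h2 : ∀ s : Finset n, ∀ ε > 0, ∃ x ∈ d,
          ∑ i ∈ s, (⟪((a : K →L[ℂ] K) - x) (v i g), v i g⟫_ℂ).re < ε := by
        intro s
        induction s using Finset.induction_on with
        | empty =>
          intro ε hε
          obtain ⟨x, hx⟩ := hne
          exact ⟨x, hx, by simpa using hε⟩
        | insert i s hi ih =>
          intro ε hε
          obtain ⟨x, hx, hxε⟩ := ih (ε / 2) (by positivity)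
          obtain ⟨y, hy, hyε⟩ := exists_inner_lt_of_isLUB hne hdir ha (v i g)
            (show 0 < ε / 2 by positivity)
          obtain ⟨z, hz, hxz, hyz⟩ := hdir x hx y hy
          have hanti : ∀ x z : A, x ≤ z → ∀ k, (⟪((a : K →L[ℂ] K) - z) k, k⟫_ℂ).re ≤
              (⟪((a : K →L[ℂ] K) - x) k, k⟫_ℂ).re := by
            intro x z hxz k
            have := (Complex.nonneg_iff.mp (inner_sub_nonneg
              (show (x : K →L[ℂ] K) ≤ z from hxz) k)).1
            simp only [sub_apply, inner_sub_left, Complex.sub_re] at this ⊢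
            linarith
          refine ⟨z, hz, ?_⟩
          rw [Finset.sum_insert hi]
          have h3 := Finset.sum_le_sum fun i (_ : i ∈ s) => hanti x z hxz (v i g)
          have h4 := hanti y z hyz (v i g)
          linarith
      obtain ⟨x, hx, hxε⟩ := h2 Finset.univ ε hε
      refine ⟨_, ⟨_, ⟨x, hx, rfl⟩, rfl⟩, ?_⟩
      simpa only [sub_apply, inner_sub_left, h, Complex.sub_re, Complex.re_sum,
        Finset.sum_sub_distrib] using hxε
  refine ⟨fun y hy => h1.1 ⟨y, hy, rfl⟩, fun z hz => h1.2 ?_⟩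
  rintro _ ⟨y, hy, rfl⟩
  exact hz hy

lemma scottContinuous_conj (c : A) : ScottContinuous fun x : A => star c * x * c :=
  scottContinuous_of_inner_eq (n := Unit) (fun _ _ hxy => star_left_conjugate_le_conjugate hxy c)
    (fun _ g => (c : K →L[ℂ] K) g) fun x h => by
      rw [Fintype.sum_unique]
      change ⟪adjoint (c : K →L[ℂ] K) ((x : K →L[ℂ] K) ((c : K →L[ℂ] K) h)), h⟫_ℂ = _
      rw [adjoint_inner_left]

/-- The vectors `a ξ g` are total if `ξ` is cyclic. -/
lemma Bimodule.total_of_cyclic (E : Bimodule A B) {ξ : G →L[ℂ] E.H}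
    (hcyc : E.mod ≤ sotClosure (Submodule.span ℂ
      {y | ∃ (a : A) (b : B), y = E.ρ a ∘L ξ ∘L (b : G →L[ℂ] G)})) :
    (Submodule.span ℂ {h | ∃ (a : A) (g : G), E.ρ a (ξ g) = h}).topologicalClosure = ⊤ := by
  refine top_le_iff.mp (E.total.symm.le.trans ?_)
  refine Submodule.topologicalClosure_minimal _ ?_ (Submodule.isClosed_topologicalClosure _)
  rw [Submodule.span_le]
  rintro _ ⟨x, hx, g, rfl⟩
  refine sotClosure_induction (fun f => f g ∈ (Submodule.span ℂ
    {h | ∃ (a : A) (g : G), E.ρ a (ξ g) = h}).topologicalClosure) ?_ ?_ (hcyc hx)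
  · exact (Submodule.isClosed_topologicalClosure _).preimage (continuous_apply g)
  · intro y hy
    induction hy using Submodule.span_induction with
    | mem y hy =>
      obtain ⟨a, b, rfl⟩ := hy
      exact Submodule.le_topologicalClosure _ (Submodule.subset_span ⟨a, _, rfl⟩)
    | zero => exact zero_mem _
    | add y z _ _ hy hz => exact add_mem hy hz
    | smul c y _ hy => exact Submodule.smul_mem _ c hy

/-- The GNS-module of a normal map is normal. -/
lemma Bimodule.isNormal_of_cyclic (E : Bimodule A B) {ξ : G →L[ℂ] E.H}
    (hcyc : E.mod ≤ sotClosure (Submodule.span ℂ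
      {y | ∃ (a : A) (b : B), y = E.ρ a ∘L ξ ∘L (b : G →L[ℂ] G)}))
    {φ : A → B} (hφ : ScottContinuous φ)
    (hgns : ∀ a, adjoint ξ ∘L E.ρ a ∘L ξ = (φ a : G →L[ℂ] G)) : E.IsNormal := by
  intro d hne hdir a ha
  have : Nonempty d := hne.to_subtype
  have : IsDirectedOrder d := directedOn_iff_isDirectedOrder.mp hdir
  have hmono : ∀ x y : A, x ≤ y → E.ρ x ≤ E.ρ y := fun x y hxy => OrderHomClass.mono E.ρ hxy
  -- Square roots of the gaps turn weak convergence of `ρ x` to `ρ a` into strong convergence of `ρ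
  -- (s x)` to `0`. The latter is an eventually bounded net, so it can be tested on a total set.
  have hs : ∀ x : d, ∃ s : A, a - x = star s * s := fun x =>
    CStarAlgebra.nonneg_iff_eq_star_mul_self.mp (sub_nonneg.mpr (ha.1 x.2))
  choose s hs using hs
  have hnorm : ∀ (x : d) (h : E.H),
      (⟪(E.ρ a - E.ρ (x : A)) h, h⟫_ℂ).re = ‖E.ρ (s x) h‖ ^ 2 := by
    intro x h
    rw [← map_sub, hs, map_mul, map_star, star_eq_adjoint]
    change (⟪adjoint (E.ρ (s x)) (E.ρ (s x) h), h⟫_ℂ).re = _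
    rw [adjoint_inner_left]
    exact inner_self_eq_norm_sq (𝕜 := ℂ) _
  have hanti : ∀ (x y : d) (h : E.H), x ≤ y → ‖E.ρ (s y) h‖ ≤ ‖E.ρ (s x) h‖ := by
    intro x y h hxy
    refine le_of_sq_le_sq ?_ (norm_nonneg _)
    rw [← hnorm, ← hnorm]
    have := (Complex.nonneg_iff.mp (inner_sub_nonneg (hmono x y hxy) h)).1
    simp only [sub_apply, inner_sub_left, Complex.sub_re] at this ⊢
    linarith
  obtain ⟨x₀⟩ := ‹Nonempty d›
  have hlim := tendsto_apply_zero_of_total (l := atTop) (T := fun x : d => E.ρ (s x))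
    (C := ‖E.ρ (s x₀)‖) (by
      filter_upwards [eventually_ge_atTop x₀] with x hx h
      exact (hanti _ _ h hx).trans ((E.ρ (s x₀)).le_opNorm h)) (E.total_of_cyclic hcyc) ?_
  · refine isLUB_of_exists_inner_lt ?_ fun h ε hε => ?_
    · rintro _ ⟨x, hx, rfl⟩
      exact hmono _ _ (ha.1 hx)
    · have h1 := ((hlim h).norm.pow 2)
      rw [norm_zero, zero_pow two_ne_zero] at h1
      obtain ⟨x, hx⟩ := (h1.eventually_lt_const hε).exists
      exact ⟨_, ⟨x, x.2, rfl⟩, by rwa [hnorm]⟩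
  -- On a generating vector, `‖ρ (s x) (c ξ g)‖²` equals `⟪φ(c* (a - x) c) g, g⟫`. It becomes small
  -- because `φ` and conjugation by `c` are both normal.
  · rintro _ ⟨c, g, rfl⟩
    have hconj := scottContinuous_conj c
    have himage : ∀ {R S : Type u} [Preorder R] [Preorder S] {f : R → S} {s : Set R}, Monotone f →
        DirectedOn (· ≤ ·) s → DirectedOn (· ≤ ·) (f '' s) := fun hf hs =>
      directedOn_image.mpr (hs.mono fun _ _ h => hf h)
    have hdir' := himage hconj.monotone hdir
    have hLUB := hφ (hne.image _) hdir' (hconj hne hdir ha)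
    rw [Metric.tendsto_nhds]
    intro ε hε
    obtain ⟨_, ⟨_, ⟨x, hx, rfl⟩, rfl⟩, hlt⟩ := exists_inner_lt_of_isLUB ((hne.image _).image φ)
      (himage hφ.monotone hdir') hLUB g (show 0 < ε ^ 2 by positivity)
    filter_upwards [eventually_ge_atTop (⟨x, hx⟩ : d)] with y hy
    rw [dist_zero_right]
    refine (hanti _ _ _ hy).trans_lt (lt_of_pow_lt_pow_left₀ 2 hε.le ?_)
    rw [← hnorm]
    rw [← hgns, ← hgns] at hlt
    refine lt_of_eq_of_lt ?_ hlt
    simp only [sub_apply, map_mul, map_star, star_eq_adjoint, comp_apply, mul_apply_eq_comp,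
      adjoint_inner_left, inner_sub_left]

end Normality

/-! ### Extending operators from total sets -/

section Extension

variable {X H H' : Type*} [NormedAddCommGroup H] [InnerProductSpace ℂ H]
  [NormedAddCommGroup H'] [InnerProductSpace ℂ H'] [CompleteSpace H']

lemma denseRange_linearCombination {e : X → H}
    (he : (Submodule.span ℂ (Set.range e)).topologicalClosure = ⊤) :
    DenseRange (Finsupp.linearCombination ℂ e) := by
  have h1 := Submodule.dense_iff_topologicalClosure_eq_top.mpr he
  rwa [← Finsupp.range_linearCombination] at h1

/-- Extension of a bounded linear map from a total set. -/
lemma exists_clm_of_norm_le {e : X → H} {f : X → H'}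
    (he : (Submodule.span ℂ (Set.range e)).topologicalClosure = ⊤) (C : ℝ)
    (h : ∀ v : X →₀ ℂ, ‖Finsupp.linearCombination ℂ f v‖ ≤ C * ‖Finsupp.linearCombination ℂ e v‖) :
    ∃ T : H →L[ℂ] H', ∀ x, T (e x) = f x := by
  refine ⟨LinearMap.extendOfNorm (Finsupp.linearCombination ℂ f) (Finsupp.linearCombination ℂ e),
    fun x => ?_⟩
  have := LinearMap.extendOfNorm_eq (f := Finsupp.linearCombination ℂ f)
    (e := Finsupp.linearCombination ℂ e) (denseRange_linearCombination he) ⟨C, h⟩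
    (Finsupp.single x 1)
  simpa using this

/-- Extension of a map which preserves inner products from a total set. -/
lemma exists_isometry_of_inner_eq {e : X → H} {f : X → H'}
    (he : (Submodule.span ℂ (Set.range e)).topologicalClosure = ⊤)
    (h : ∀ x y, ⟪f x, f y⟫_ℂ = ⟪e x, e y⟫_ℂ) :
    ∃ T : H →L[ℂ] H', (∀ x, T (e x) = f x) ∧ ∀ v, ‖T v‖ = ‖v‖ := by
  have hn : ∀ v : X →₀ ℂ,
      ‖Finsupp.linearCombination ℂ f v‖ = ‖Finsupp.linearCombination ℂ e v‖ := by
    intro v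
    rw [norm_eq_sqrt_re_inner (𝕜 := ℂ), norm_eq_sqrt_re_inner (𝕜 := ℂ)]
    simp only [Finsupp.linearCombination_apply, Finsupp.sum, sum_inner, inner_sum,
      inner_smul_left, inner_smul_right, h]
  obtain ⟨T, hT⟩ := exists_clm_of_norm_le he 1 fun v => by rw [hn, one_mul]
  refine ⟨T, hT, fun v => ?_⟩
  have h1 : ∀ w, T (Finsupp.linearCombination ℂ e w) =
      Finsupp.linearCombination ℂ f w := fun w => by
    simp [Finsupp.linearCombination_apply, Finsupp.sum, hT]
  refine (denseRange_linearCombination he).induction_on v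
    (isClosed_eq (by fun_prop) (by fun_prop)) fun w => ?_
  rw [h1, hn]

end Extension

/-! ### Inclusion systems from GNS-modules -/

section Systems

variable {K G L : Type u} [NormedAddCommGroup K] [InnerProductSpace ℂ K] [CompleteSpace K]
  [NormedAddCommGroup G] [InnerProductSpace ℂ G] [CompleteSpace G]
  [NormedAddCommGroup L] [InnerProductSpace ℂ L] [CompleteSpace L]
  {A : VonNeumannAlgebra K} {B : VonNeumannAlgebra G} {C : VonNeumannAlgebra L}

/-- `ξ` generates the module `E`, that is, `E` is the strong closure of the span of `A ξ B`. -/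
def Bimodule.IsCyclic (E : Bimodule A B) (ξ : G →L[ℂ] E.H) : Prop :=
  E.mod ≤ sotClosure (Submodule.span ℂ
    {y | ∃ (a : A) (b : B), y = E.ρ a ∘L ξ ∘L (b : G →L[ℂ] G)})

lemma Bimodule.IsCyclic.total {E : Bimodule A B} {ξ : G →L[ℂ] E.H} (h : E.IsCyclic ξ) :
    (Submodule.span ℂ (Set.range fun p : A × G => E.ρ p.1 (ξ p.2))).topologicalClosure = ⊤ := by
  have h1 : (Set.range fun p : A × G => E.ρ p.1 (ξ p.2)) =
      {h | ∃ (a : A) (g : G), E.ρ a (ξ g) = h} := by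
    ext; simp
  rw [h1]
  exact E.total_of_cyclic h

lemma Bimodule.IsCyclic.ext {E : Bimodule A B} {ξ : G →L[ℂ] E.H} (h : E.IsCyclic ξ)
    {M : Type*} [NormedAddCommGroup M] [NormedSpace ℂ M] {S T : E.H →L[ℂ] M}
    (hST : ∀ a g, S (E.ρ a (ξ g)) = T (E.ρ a (ξ g))) : S = T := by
  refine ContinuousLinearMap.ext_on (Submodule.dense_iff_topologicalClosure_eq_top.mpr h.total) ?_
  rintro _ ⟨⟨a, g⟩, rfl⟩
  exact hST a g

/-- Inner products of generating vectors depend only on the moments `a ↦ ξ* ρ(a) ζ`. Equal moments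
therefore give isometric cyclic modules. -/
lemma PreBimodule.inner_ρ_ρ (E : PreBimodule A B) {M : Type*} [NormedAddCommGroup M]
    [InnerProductSpace ℂ M] [CompleteSpace M] (ξ ζ : M →L[ℂ] E.H) (a a' : A) (g g' : M) :
    ⟪E.ρ a (ξ g), E.ρ a' (ζ g')⟫_ℂ = ⟪g, (adjoint ξ ∘L E.ρ (star a * a') ∘L ζ) g'⟫_ℂ := by
  simp only [comp_apply, adjoint_inner_right, map_mul, map_star, star_eq_adjoint,
    mul_apply_eq_comp]

/-- The universal property of the GNS-module. -/
lemma Bimodule.IsCyclic.exists_hom {E F : Bimodule A B} {ξ : G →L[ℂ] E.H} (h : E.IsCyclic ξ)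
    {ζ : G →L[ℂ] F.H} (hζ : ζ ∈ F.mod)
    (hgns : ∀ a, adjoint ζ ∘L F.ρ a ∘L ζ = adjoint ξ ∘L E.ρ a ∘L ξ) :
    ∃ T : Hom E F, T.IsIsometry ∧ T.op ∘L ξ = ζ := by
  obtain ⟨T, hT, hiso⟩ := exists_isometry_of_inner_eq h.total
    (f := fun p : A × G => F.ρ p.1 (ζ p.2)) fun p q => by
      rw [F.inner_ρ_ρ, E.inner_ρ_ρ, hgns]
  have hT' : ∀ a g, T (E.ρ a (ξ g)) = F.ρ a (ζ g) := fun a g => hT (a, g)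
  have hint : ∀ a : A, T ∘L E.ρ a = F.ρ a ∘L T := fun a => h.ext fun a' g => by
    simp only [comp_apply, hT', ← mul_apply_eq_comp, ← map_mul]
  refine ⟨Hom.mk' T (fun x hx => F.sotClosed ?_) fun a v => congrArg (fun S => S v) (hint a), hiso,
    ?_⟩
  · refine sotClosure_map T (ContinuousLinearMap.id ℂ G) (fun y hy => ?_) (h hx)
    induction hy using Submodule.span_induction with
    | mem y hy =>
      obtain ⟨a, b, rfl⟩ := hy
      have h1 : T ∘L (E.ρ a ∘L ξ ∘L (b : G →L[ℂ] G)) ∘L ContinuousLinearMap.id ℂ G =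
          F.ρ a ∘L ζ ∘L (b : G →L[ℂ] G) := by
        ext g
        exact hT' a _
      rw [h1]
      exact F.left_mem a _ (F.right_mem ζ hζ b)
    | zero => simp
    | add y z _ _ hy hz => simpa using add_mem hy hz
    | smul c y _ hy => simpa using Submodule.smul_mem _ c hy
  · ext g
    have h1 := hT' 1 g
    rw [map_one, map_one] at h1
    exact h1

lemma adjoint_tmul_comp (E : PreBimodule A B) (F : PreBimodule B C) (x x' : E.mod) (y y' : F.mod) :
    adjoint (tmul E F x y) ∘L tmul E F x' y' =
      adjoint (y : L →L[ℂ] F.H) ∘L F.ρ (E.inn x x') ∘L (y' : L →L[ℂ] F.H) := by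
  ext k
  refine ext_inner_left ℂ fun k' => ?_
  simp only [comp_apply, adjoint_inner_right, tmul]
  exact inner_tmulOp _ _ _ _ _ _

lemma tensorρ_comp_tmul (E : PreBimodule A B) (F : PreBimodule B C) (a : A) (x : E.mod)
    (y : F.mod) : tensorρ E F a ∘L tmul E F x y = tmul E F ⟨_, E.left_mem a x x.2⟩ y :=
  ContinuousLinearMap.ext fun _ => tensorρ_tmulOp E F a x _

/-- The tensor product is balanced over `B`: both sides pair in the same way with every `z ⊗ k`, as
`⟨z, x b⟩ = ⟨z, x⟩ b`. -/
lemma tmulOp_right (E : PreBimodule A B) (F : PreBimodule B C) (x : E.mod) (b : B) (h : F.H) :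
    tmulOp E F ⟨_, E.right_mem x x.2 b⟩ h = tmulOp E F x (F.ρ b h) :=
  tensorH_ext_inner fun z k => by
    rw [inner_tmulOp, inner_tmulOp, ← mul_apply_eq_comp, ← map_mul]
    rfl

/-- An adjointable bilinear map which sends `ξ` to `ζ ⊙ ζ'` sends `a ξ` to `a ζ ⊙ ζ'`. -/
lemma Hom.op_ρ_apply {M : Bimodule A C} {E : Bimodule A B} {F : Bimodule B C}
    (T : Hom M (E.tensor F)) {ξ : L →L[ℂ] M.H} {ζ : E.mod} {ζ' : F.mod}
    (h : T.op ∘L ξ = (E.tmul F ζ ζ' : L →L[ℂ] (E.tensor F).H)) (a : A) (g : L) :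
    T.op (M.ρ a (ξ g)) = tmulOp E.toPreBimodule F.toPreBimodule ⟨_, E.left_mem a ζ ζ.2⟩
      ((ζ' : L →L[ℂ] F.H) g) := by
  rw [T.intertwines]
  refine (congrArg ((E.tensor F).ρ a)
    (congrArg (fun T : L →L[ℂ] (E.tensor F).H => T g) h)).trans ?_
  exact tensorρ_tmulOp E.toPreBimodule F.toPreBimodule a ζ _

/-- The chain is `b ζ ⊙ ζ' = x ⊙ ζ' = x b ⊙ ζ' = x ⊙ b ζ' = x ⊙ x'`. It is meant for a projection
`b` that commutes with `ζ`, so that `x = b ζ` absorbs `b` from the right. -/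
lemma Hom.op_comp_ρ_comp {E F F' : Bimodule B B} {η : G →L[ℂ] E.H} {ζ x : F.mod} {ζ' x' : F'.mod}
    (T : Hom E (F.tensor F'))
    (hT : T.op ∘L η = (F.tmul F' ζ ζ' : G →L[ℂ] (F.tensor F').H)) (b : B)
    (hx : (x : G →L[ℂ] F.H) = F.ρ b ∘L (ζ : G →L[ℂ] F.H))
    (hxb : (x : G →L[ℂ] F.H) = (x : G →L[ℂ] F.H) ∘L (b : G →L[ℂ] G))
    (hx' : (x' : G →L[ℂ] F'.H) = F'.ρ b ∘L (ζ' : G →L[ℂ] F'.H)) :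
    T.op ∘L E.ρ b ∘L η = (F.tmul F' x x' : G →L[ℂ] (F.tensor F').H) := by
  ext v
  refine (T.op_ρ_apply hT b v).trans ?_
  have h1 : (⟨_, F.left_mem b ζ ζ.2⟩ : F.mod) = x := Subtype.ext hx.symm
  have h2 : x = ⟨_, F.right_mem x x.2 b⟩ := Subtype.ext hxb
  rw [h1]
  refine (congrArg (fun z => tmulOp F.toPreBimodule F'.toPreBimodule z
    ((ζ' : G →L[ℂ] F'.H) v)) h2).trans ?_
  refine (tmulOp_right F.toPreBimodule F'.toPreBimodule _ _ _).trans ?_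
  exact congrArg (tmulOp F.toPreBimodule F'.toPreBimodule x)
    (congrArg (fun S : G →L[ℂ] F'.H => S v) hx').symm

/-- A family of GNS-modules of a normal semigroup carries the structure of an
associated inclusion system. -/
theorem exists_inclusionSystem {E : ℝ≥0 → Bimodule B B} (ξ : ∀ t, (E t).mod) {φ : ℝ≥0 → B → B}
    (hφ : ∀ t, ScottContinuous (φ t)) (h_zero : ∀ a, φ 0 a = a)
    (h_add : ∀ s t a, φ (s + t) a = φ s (φ t a))
    (hgns : ∀ t a, adjoint (ξ t : G →L[ℂ] (E t).H) ∘L (E t).ρ a ∘L (ξ t : G →L[ℂ] (E t).H) =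
      (φ t a : G →L[ℂ] G))
    (hcyc : ∀ t, (E t).IsCyclic (ξ t : G →L[ℂ] (E t).H)) :
    ∃ S : InclusionSystem E, IsAssociated S ξ φ := by
  -- Since `φ 0` is the identity, `ξ 0` and `1 ∈ B` have the same moments. Surjectivity of `Z`
  -- follows from `Z (ξ 0 g) = g`.
  obtain ⟨Z, hZ, hZξ⟩ := (hcyc 0).exists_hom (F := Bimodule.self B)
    (ζ := ContinuousLinearMap.id ℂ G) (one_mem B) fun a => by
      rw [hgns, h_zero]
      exact congrArg (fun T : G →L[ℂ] G => T ∘L (a : G →L[ℂ] G) ∘L ContinuousLinearMap.id ℂ G)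
        adjoint_id
  have hβ : ∀ s t r : ℝ≥0, s + t = r → ∃ T : Hom (E r) ((E s).tensor (E t)), T.IsIsometry ∧
      T.op ∘L (ξ r : G →L[ℂ] (E r).H) =
        ((E s).tmul (E t) (ξ s) (ξ t) : G →L[ℂ] ((E s).tensor (E t)).H) := by
    rintro s t r rfl
    refine (hcyc _).exists_hom ((E s).tmul (E t) (ξ s) (ξ t)).2 fun a => ?_
    refine (congrArg _ (tensorρ_comp_tmul (E s).toPreBimodule (E t).toPreBimodule a _ _)).trans ?_
    refine (adjoint_tmul_comp (E s).toPreBimodule (E t).toPreBimodule _ _ _ _).trans ?_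
    have h1 : (E s).inn (ξ s) ⟨_, (E s).left_mem a (ξ s) (ξ s).2⟩ = φ s a := Subtype.ext (hgns s a)
    -- In `ξ_s ⊙ ξ_t` the inner map is `φ s` and the outer one `φ t`, the reverse of the order in
    -- `h_add`; commutativity of time reconciles them.
    rw [h1, hgns, hgns, add_comm, h_add]
  choose β hiso hβξ using hβ
  have hβρ := fun s t r h a g => (β s t r h).op_ρ_apply (hβξ s t r h) a g
  refine ⟨{ normal := fun t => (E t).isNormal_of_cyclic (hcyc t) (hφ t) (hgns t)
            zero := Z
            zero_unitary := ⟨hZ, fun g => ⟨(ξ 0 : G →L[ℂ] (E 0).H) g,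
              congrArg (fun T : G →L[ℂ] G => T g) hZξ⟩⟩
            β := β
            isometry := hiso
            coassoc := ?_ },
    { gns := hgns
      cyclic := hcyc
      unit := hβξ
      zero := hZξ }⟩
  intro r s t u v w hu hv hw hw' x y k z
  -- Both sides are bounded functionals of `z`, so it suffices to take `z = a ξ_w g`. There both
  -- composites produce `a ξ_r ⊗ ξ_s ⊗ ξ_t g`, up to the bracketing.
  have key : innerSL ℂ (((E r).tensor (E s)).tvec (E t) ((E r).tmul (E s) x y) k) ∘L
        (β r s u hu).tensorOp (Hom.id (E t)) ∘L (β u t w hw).op =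
      innerSL ℂ ((E r).tvec ((E s).tensor (E t)) x ((E s).tvec (E t) y k)) ∘L
        (Hom.id (E r)).tensorOp (β s t v hv) ∘L (β r v w hw').op := by
    refine (hcyc w).ext fun a g => ?_
    simp only [comp_apply, innerSL_apply_apply]
    rw [hβρ, hβρ, Hom.tensorOp_tmulOp, Hom.tensorOp_tmulOp]
    have h1 : (β s t v hv).op ((ξ v : G →L[ℂ] (E v).H) g) =
        tmulOp (E s).toPreBimodule (E t).toPreBimodule (ξ s) ((ξ t : G →L[ℂ] (E t).H) g) :=
      congrArg (fun T : G →L[ℂ] ((E s).tensor (E t)).H => T g) (hβξ s t v hv)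
    rw [h1]
    refine (inner_tmulOp _ _ _ _ _ _).trans (Eq.trans ?_ (inner_tmulOp _ _ _ _ _ _).symm)
    have h2 := tensorρ_tmulOp (E s).toPreBimodule (E t).toPreBimodule
      ((E r).inn x ⟨_, (E r).left_mem a (ξ r) (ξ r).2⟩) (ξ s) ((ξ t : G →L[ℂ] (E t).H) g)
    refine Eq.trans ?_ (congrArg (fun w => ⟪(E s).tvec (E t) y k, w⟫_ℂ) h2).symm
    refine Eq.trans ?_ (inner_tmulOp _ _ _ _ _ _).symm
    refine congrArg (fun b => ⟪k, (E t).ρ b ((ξ t : G →L[ℂ] (E t).H) g)⟫_ℂ) (Subtype.ext ?_)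
    refine Eq.trans ?_ (adjoint_tmul_comp (E r).toPreBimodule (E s).toPreBimodule x
      ⟨_, (E r).left_mem a (ξ r) (ξ r).2⟩ y (ξ s))
    refine congrArg (fun T => adjoint (tmul (E r).toPreBimodule (E s).toPreBimodule x y) ∘L T) ?_
    exact ContinuousLinearMap.ext fun g => hβρ r s u hu a g
  exact congrArg (fun T => T z) key

end Systems

/-! ### The GNS-module of a completely positive map -/

section GNS

variable {G : Type u} [NormedAddCommGroup G] [InnerProductSpace ℂ G] [CompleteSpace G]
  {B : VonNeumannAlgebra G}

/-- Complete positivity enters the GNS construction here: `D₀* D₀` is a positive matrix, its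
entrywise image under `Φ` is again positive, and so it factorizes. -/
lemma cp_gram {R n : Type*} [CStarAlgebra R] [PartialOrder R] [StarOrderedRing R]
    [Fintype n] [DecidableEq n] (Φ : CompletelyPositiveMap R R) {m D₀ : n → n → R}
    (h : ∀ i j, m i j = ∑ k, star (D₀ k i) * D₀ k j) :
    ∃ D : n → n → R, ∀ i j, Φ (m i j) = ∑ k, star (D k i) * D k j := by
  let M : CStarMatrix n n R := CStarMatrix.ofMatrix m
  let D : CStarMatrix n n R := CStarMatrix.ofMatrix D₀
  have hM : M = star D * D := by
    apply CStarMatrix.ext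
    intro i j
    rw [CStarMatrix.mul_apply]
    exact h i j
  have hpos : 0 ≤ M := by
    rw [hM]
    exact star_mul_self_nonneg D
  obtain ⟨D', hD'⟩ := exists_star_mul_self (Φ.map_cstarMatrix_nonneg M hpos)
  exact ⟨fun i j => D' i j, fun i j =>
    (congrFun (congrFun hD' i) j).trans CStarMatrix.mul_apply⟩

lemma cp_gram_factor (Φ : CompletelyPositiveMap B B) {n : Type*} [Fintype n]
    [DecidableEq n] (a : n → B) :
    ∃ D : n → n → B, ∀ i j, Φ (star (a i) * a j) = ∑ k, star (D k i) * D k j := by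
  obtain ⟨D₀, hD₀⟩ := gram_factor B (fun i => (a i : G →L[ℂ] G))
    fun i j => (star (a i) * a j).2
  exact cp_gram Φ hD₀

/-- The kernel `(a, b) ↦ Φ(a* b)` of a completely positive map. -/
def gnsKernel (Φ : CompletelyPositiveMap B B) : Matrix B B (G →L[ℂ] G) :=
  Matrix.of fun a b => (Φ (star a * b) : G →L[ℂ] G)

/-- Hermitian symmetry is read off from the factorized 2×2 Gram matrix of `a` and `b`. -/
lemma cp_star_map (Φ : CompletelyPositiveMap B B) (a b : B) :
    star (Φ (star a * b)) = Φ (star b * a) := by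
  classical
  obtain ⟨D, hD⟩ := cp_gram_factor Φ ![a, b]
  have h1 := hD 0 1
  have h2 := hD 1 0
  simp only [Matrix.cons_val_zero, Matrix.cons_val_one] at h1 h2
  rw [h1, h2]
  simp [star_mul]

/-- After factorizing `Φ (star a * b)` over the finite support, `gram_quad` writes the quadratic
form as a sum of squared norms. -/
lemma gnsKernel_posSemidef (Φ : CompletelyPositiveMap B B) : (gnsKernel Φ).PosSemidef := by
  have hiff := (RKHS.posSemidef_tfae (K := gnsKernel Φ)).out 0 2
  refine hiff.mpr ⟨?_, fun vv => ?_⟩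
  · ext1 x y
    exact congrArg Subtype.val (cp_star_map Φ y x)
  · classical
    obtain ⟨D, hD⟩ := cp_gram_factor Φ fun i : vv.support => (i : B)
    have h := gram_quad B hD (StarSubalgebra.subtype B.toStarSubalgebra) (fun i => vv i)
    have h2 : (vv.sum fun x w => vv.sum fun x' w' => ⟪gnsKernel Φ x' x w, w'⟫_ℂ) =
        ∑ i : vv.support, ∑ j : vv.support,
          ⟪(Φ (star (j : B) * i) : G →L[ℂ] G) (vv i), vv j⟫_ℂ := by
      simp only [Finsupp.sum]
      rw [← Finset.sum_coe_sort]
      refine Finset.sum_congr rfl fun i _ => ?_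
      rw [← Finset.sum_coe_sort]
      rfl
    rw [h2]
    refine (congrArg Complex.re h).ge.trans' ?_
    rw [Complex.ofReal_re]
    exact Finset.sum_nonneg fun k _ => sq_nonneg _

/-- The Hilbert space of the Stinespring representation: it is generated by vectors `a ⊗ g` with
`⟪a ⊗ g, b ⊗ k⟫ = ⟪g, Φ(a* b) k⟫`. -/
lemma exists_gns_space (Φ : CompletelyPositiveMap B B) :
    ∃ (H : Type u) (_ : NormedAddCommGroup H) (_ : InnerProductSpace ℂ H) (_ : CompleteSpace H)
      (e : B → G →L[ℂ] H),
      (∀ a b g k, ⟪e a g, e b k⟫_ℂ = ⟪g, (Φ (star a * b) : G →L[ℂ] G) k⟫_ℂ) ∧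
      (Submodule.span ℂ (Set.range fun p : B × G => e p.1 p.2)).topologicalClosure = ⊤ := by
  have : Fact (gnsKernel Φ).PosSemidef := ⟨gnsKernel_posSemidef Φ⟩
  refine ⟨RKHS.OfKernel (gnsKernel Φ), inferInstance, inferInstance, inferInstance,
    RKHS.kerFun _, fun a b g k => ?_, ?_⟩
  · have h1 := RKHS.kernel_inner (RKHS.OfKernel (gnsKernel Φ)) b a g k
    rw [RKHS.OfKernel.kernel_ofKernel] at h1
    refine h1.symm.trans ?_
    change ⟪(Φ (star b * a) : G →L[ℂ] G) g, k⟫_ℂ = _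
    rw [← adjoint_inner_right]
    exact congrArg (fun T : B => ⟪g, (T : G →L[ℂ] G) k⟫_ℂ) (cp_star_map Φ b a)
  · refine Eq.trans ?_ (RKHS.kerFun_dense (RKHS.OfKernel (gnsKernel Φ)))
    congr 2
    ext
    simp

/-- A relation between Gram kernels passes to squared norms of linear combinations. Since the left
side is nonnegative, `f` is dominated by `√r` times `e`, which is how left multiplication is
bounded. -/
lemma norm_sq_linearCombination_of_inner_eq {X H H' H'' : Type*}
    [NormedAddCommGroup H] [InnerProductSpace ℂ H] [NormedAddCommGroup H']
    [InnerProductSpace ℂ H'] [NormedAddCommGroup H''] [InnerProductSpace ℂ H'']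
    {e : X → H} {f : X → H'} {f' : X → H''} {r : ℝ}
    (h : ∀ x y, ⟪f' x, f' y⟫_ℂ = r * ⟪e x, e y⟫_ℂ - ⟪f x, f y⟫_ℂ) (v : X →₀ ℂ) :
    ‖Finsupp.linearCombination ℂ f' v‖ ^ 2 = r * ‖Finsupp.linearCombination ℂ e v‖ ^ 2 -
      ‖Finsupp.linearCombination ℂ f v‖ ^ 2 := by
  have h1 : ⟪Finsupp.linearCombination ℂ f' v, Finsupp.linearCombination ℂ f' v⟫_ℂ =
      r * ⟪Finsupp.linearCombination ℂ e v, Finsupp.linearCombination ℂ e v⟫_ℂ -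
        ⟪Finsupp.linearCombination ℂ f v, Finsupp.linearCombination ℂ f v⟫_ℂ := by
    simp only [Finsupp.linearCombination_apply, Finsupp.sum, sum_inner, inner_sum,
      inner_smul_left, inner_smul_right, h, Finset.mul_sum, ← Finset.sum_sub_distrib]
    refine Finset.sum_congr rfl fun i _ => Finset.sum_congr rfl fun j _ => ?_
    ring
  have h2 := congrArg Complex.re h1
  rw [Complex.sub_re, Complex.re_ofReal_mul] at h2
  simp only [← inner_self_eq_norm_sq (𝕜 := ℂ)]
  exact h2

/-- The left multiplication operators on the Stinespring space. -/
lemma exists_left_mul (Φ : CompletelyPositiveMap B B) {H : Type*} [NormedAddCommGroup H]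
    [InnerProductSpace ℂ H] [CompleteSpace H] {e : B → G →L[ℂ] H}
    (he : ∀ a b g k, ⟪e a g, e b k⟫_ℂ = ⟪g, (Φ (star a * b) : G →L[ℂ] G) k⟫_ℂ)
    (hd : (Submodule.span ℂ (Set.range fun p : B × G => e p.1 p.2)).topologicalClosure = ⊤)
    (b : B) : ∃ T : H →L[ℂ] H, ∀ a g, T (e a g) = e (b * a) g := by
  -- The element `d` satisfies `d* d = ‖b‖² - b* b`. Thus the vectors `e (d a) g` measure the
  -- deficit in the estimate `‖b v‖² ≤ ‖b‖² ‖v‖²`.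
  obtain ⟨d, hd'⟩ := exists_star_mul_self
    (sub_nonneg.mpr (CStarAlgebra.star_mul_le_algebraMap_norm_sq (a := b)))
  obtain ⟨T, hT⟩ := exists_clm_of_norm_le (f := fun p : B × G => e (b * p.1) p.2) hd ‖b‖ fun v => by
    have h1 := norm_sq_linearCombination_of_inner_eq (e := fun p : B × G => e p.1 p.2)
      (f := fun p : B × G => e (b * p.1) p.2) (f' := fun p : B × G => e (d * p.1) p.2)
      (r := ‖b‖ ^ 2) (fun p q => by
        rw [he, he, he]
        have h2 : star (d * p.1) * (d * q.1) =
            ((‖b‖ ^ 2 : ℝ) : ℂ) • (star p.1 * q.1) - star (b * p.1) * (b * q.1) := by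
          rw [star_mul, star_mul, mul_assoc, ← mul_assoc (star d), ← hd', sub_mul, mul_sub,
            Algebra.algebraMap_eq_smul_one, smul_mul_assoc, one_mul, mul_smul_comm, mul_assoc,
            mul_assoc]
          rfl
        rw [h2, map_sub, map_smul, ← inner_smul_right, ← inner_sub_right]
        rfl) v
    refine le_of_sq_le_sq ?_ (by positivity)
    rw [mul_pow]
    linarith [sq_nonneg ‖Finsupp.linearCombination ℂ (fun p : B × G => e (d * p.1) p.2) v‖]
  exact ⟨T, fun a g => hT (a, g)⟩

/-- The GNS-module of a completely positive map. -/
theorem exists_gns (Φ : CompletelyPositiveMap B B) : ∃ (E : Bimodule B B) (ξ : E.mod),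
    (∀ a, adjoint (ξ : G →L[ℂ] E.H) ∘L E.ρ a ∘L (ξ : G →L[ℂ] E.H) = (Φ a : G →L[ℂ] G)) ∧
      E.IsCyclic (ξ : G →L[ℂ] E.H) := by
  obtain ⟨H, _, _, _, e, he, hd⟩ := exists_gns_space Φ
  choose T hT using exists_left_mul Φ he hd
  have hext : ∀ {S S' : H →L[ℂ] H}, (∀ a g, S (e a g) = S' (e a g)) → S = S' := by
    intro S S' h
    refine ContinuousLinearMap.ext_on (Submodule.dense_iff_topologicalClosure_eq_top.mpr hd) ?_
    rintro _ ⟨⟨a, g⟩, rfl⟩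
    exact h a g
  have hext' : ∀ {v w : H}, (∀ a g, ⟪e a g, v⟫_ℂ = ⟪e a g, w⟫_ℂ) → v = w := by
    intro v w h
    refine ext_inner_left ℂ fun z => ?_
    have h1 : innerSL ℂ v = innerSL ℂ w := by
      refine ContinuousLinearMap.ext_on (Submodule.dense_iff_topologicalClosure_eq_top.mpr hd) ?_
      rintro _ ⟨⟨a, g⟩, rfl⟩
      simp only [innerSL_apply_apply]
      rw [← inner_conj_symm, h, inner_conj_symm]
    have h2 := congrArg (fun f => f z) h1
    simp only [innerSL_apply_apply] at h2
    rw [← inner_conj_symm, h2, inner_conj_symm]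
  -- Linearity of `e` in its algebra argument is not part of its construction; it follows from
  -- linearity of `Φ`, as vectors are determined by their inner products with the total set.
  have he_add : ∀ a b g, e (a + b) g = e a g + e b g := fun a b g => hext' fun c k => by
    rw [inner_add_right, he, he, he, mul_add, map_add, ← inner_add_right]
    rfl
  have he_smul : ∀ (z : ℂ) a g, e (z • a) g = z • e a g := fun z a g => hext' fun c k => by
    rw [inner_smul_right, he, he, mul_smul_comm, map_smul, ← inner_smul_right]
    rfl
  have he_right : ∀ a b : B, adjoint (e a) ∘L e b = (Φ (star a * b) : G →L[ℂ] G) := by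
    intro a b
    ext k
    refine ext_inner_left ℂ fun g => ?_
    rw [comp_apply, adjoint_inner_right, he]
  let ρ : B →⋆ₐ[ℂ] (H →L[ℂ] H) :=
    { toFun := T
      map_one' := hext fun a g => by rw [hT, one_mul]; rfl
      map_mul' := fun a b => hext fun c g => by rw [hT, mul_apply_eq_comp, hT, hT, mul_assoc]
      map_zero' := hext fun a g => by
        have h1 := he_smul 0 a g
        rw [zero_smul, zero_smul] at h1
        rw [hT, zero_mul, h1, zero_apply]
      map_add' := fun a b => hext fun c g => by
        rw [hT, add_apply, hT, hT, add_mul, he_add]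
      commutes' := fun z => hext fun c g => by
        rw [hT, Algebra.algebraMap_eq_smul_one, Algebra.algebraMap_eq_smul_one, smul_mul_assoc,
          one_mul, he_smul]
        rfl
      map_star' := fun a => hext fun c g => hext' fun c' g' => by
        rw [hT, star_eq_adjoint, adjoint_inner_right, hT, he, he, star_mul, mul_assoc] }
  have hρ : ∀ a c, ρ a ∘L e c = e (a * c) := fun a c => ContinuousLinearMap.ext fun g => hT a c g
  let S : Submodule ℂ (G →L[ℂ] H) :=
    Submodule.span ℂ {y | ∃ a b : B, y = ρ a ∘L e 1 ∘L (b : G →L[ℂ] G)}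
  have hS : ∀ a b : B, e a ∘L (b : G →L[ℂ] G) ∈ S := fun a b =>
    Submodule.subset_span ⟨a, b, by rw [← comp_assoc, hρ, mul_one]⟩
  have hSe : ∀ a : B, e a ∈ S := fun a => hS a 1
  refine ⟨{ H := H, ρ := ρ, mod := sotClosure S, right_mem := fun z hz c => ?_,
            left_mem := fun a z hz => ?_, inner_mem := fun z hz w hw => ?_,
            sotClosed := sotClosure_idem _, total := ?_ }, ⟨e 1, le_sotClosure _ (hSe 1)⟩,
    fun a => ?_, fun x hx => hx⟩
  · refine sotClosure_map (ContinuousLinearMap.id ℂ H) (c : G →L[ℂ] G) (fun y hy => ?_) hz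
    induction hy using Submodule.span_induction with
    | mem y hy =>
      obtain ⟨a, b, rfl⟩ := hy
      exact Submodule.subset_span ⟨a, b * c, rfl⟩
    | zero => simp
    | add y z _ _ hy hz => simpa using add_mem hy hz
    | smul c y _ hy => simpa using Submodule.smul_mem _ c hy
  · refine sotClosure_map (ρ a) (ContinuousLinearMap.id ℂ G) (fun y hy => ?_) hz
    induction hy using Submodule.span_induction with
    | mem y hy =>
      obtain ⟨a', b, rfl⟩ := hy
      refine Submodule.subset_span ⟨a * a', b, ?_⟩
      rw [map_mul]
      rfl
    | zero => simp
    | add y z _ _ hy hz => simpa using add_mem hy hz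
    | smul c y _ hy => simpa using Submodule.smul_mem _ c hy
  · refine sotClosure_inner_mem B (fun z hz w hw => ?_) hz hw
    induction hz using Submodule.span_induction with
    | zero => simp
    | add z z' _ _ hz hz' => simpa [add_comp] using add_mem hz hz'
    | smul c z _ hz =>
      have h1 : adjoint (c • z) ∘L w = star c • (adjoint z ∘L w) := by
        rw [map_smulₛₗ, smul_comp]
        rfl
      rw [h1]
      exact SMulMemClass.smul_mem (star c) hz
    | mem z hz =>
    induction hw using Submodule.span_induction with
    | zero => simp
    | add z z' _ _ hz hz' => simpa [comp_add] using add_mem hz hz'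
    | smul c z _ hz => simpa [comp_smul] using SMulMemClass.smul_mem c hz
    | mem w hw =>
    obtain ⟨a, b, rfl⟩ := hz
    obtain ⟨a', b', rfl⟩ := hw
    have h1 : adjoint (ρ a ∘L e 1 ∘L (b : G →L[ℂ] G)) ∘L (ρ a' ∘L e 1 ∘L (b' : G →L[ℂ] G)) =
        ((star b * Φ (star a * a') * b' : B) : G →L[ℂ] G) := by
      rw [← comp_assoc (ρ a), ← comp_assoc (ρ a'), hρ, hρ, mul_one, mul_one, adjoint_comp,
        comp_assoc, ← comp_assoc (adjoint (e a)), he_right, mul_assoc]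
      rfl
    rw [h1]
    exact Subtype.property _
  · refine top_le_iff.mp (hd.symm.le.trans (Submodule.topologicalClosure_mono ?_))
    rw [Submodule.span_le]
    rintro _ ⟨⟨a, g⟩, rfl⟩
    exact Submodule.subset_span ⟨e a, le_sotClosure _ (hSe a), g, rfl⟩
  · change adjoint (e 1) ∘L ρ a ∘L e 1 = _
    rw [hρ, mul_one, he_right, star_one, one_mul]

end GNS

/-! ### Bilinear maps between cyclic modules -/

section Morphisms

variable {K G : Type u} [NormedAddCommGroup K] [InnerProductSpace ℂ K] [CompleteSpace K]
  [NormedAddCommGroup G] [InnerProductSpace ℂ G] [CompleteSpace G]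
  {A : VonNeumannAlgebra K} {B : VonNeumannAlgebra G}

lemma Bimodule.IsCyclic.ext_inner {E : Bimodule A B} {ξ : G →L[ℂ] E.H} (h : E.IsCyclic ξ)
    {v w : E.H} (hvw : ∀ a g, ⟪E.ρ a (ξ g), v⟫_ℂ = ⟪E.ρ a (ξ g), w⟫_ℂ) : v = w := by
  refine ext_inner_left ℂ fun z => ?_
  have h1 : innerSL ℂ v = innerSL ℂ w := h.ext fun a g => by
    simp only [innerSL_apply_apply]
    rw [← inner_conj_symm, hvw, inner_conj_symm]
  have h2 := congrArg (fun f => f z) h1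
  simp only [innerSL_apply_apply] at h2
  rw [← inner_conj_symm, h2, inner_conj_symm]

/-- Matrix elements of a bilinear map in terms of the generating vectors. -/
lemma Hom.inner_ρ_op_ρ {E F : Bimodule A B} (T : Hom E F) (ξ : G →L[ℂ] E.H) (ζ : G →L[ℂ] F.H)
    (a a' : A) (g g' : G) : ⟪F.ρ a' (ζ g'), T.op (E.ρ a (ξ g))⟫_ℂ =
      ⟪g', (adjoint ζ ∘L T.op ∘L E.ρ (star a' * a) ∘L ξ) g⟫_ℂ := by
  rw [comp_apply, adjoint_inner_right, comp_apply, comp_apply, T.intertwines, T.intertwines,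
    map_mul, map_star, star_eq_adjoint, mul_apply_eq_comp, adjoint_inner_right]

/-- By bilinearity `⟨a' ζ, T a ξ⟩ = ⟨ζ, T a'* a ξ⟩`, so the single function `a ↦ ⟨ζ, T a ξ⟩` fixes
all matrix elements on total sets. Uniqueness of the morphism is an instance. -/
lemma Hom.ext_of_cyclic {E F : Bimodule A B} {ξ : G →L[ℂ] E.H} {ζ : G →L[ℂ] F.H}
    (hξ : E.IsCyclic ξ) (hζ : F.IsCyclic ζ) {S T : Hom E F}
    (h : ∀ a, adjoint ζ ∘L S.op ∘L E.ρ a ∘L ξ = adjoint ζ ∘L T.op ∘L E.ρ a ∘L ξ) : S = T :=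
  Hom.ext <| hξ.ext fun a g => hζ.ext_inner fun a' g' => by
    rw [S.inner_ρ_op_ρ, T.inner_ρ_op_ρ, h]

/-- Bilinear maps whose matrix elements between the generating vectors form a semigroup satisfy the
morphism relation. -/
lemma op_eq_of_semigroup {E F : ℝ≥0 → Bimodule B B} {S : InclusionSystem E}
    {S' : InclusionSystem F} {ξ : ∀ t, (E t).mod} {ζ : ∀ t, (F t).mod} {φ φ' : ℝ≥0 → B → B}
    (hS : IsAssociated S ξ φ) (hS' : IsAssociated S' ζ φ') (T : ∀ t, Hom (E t) (F t))
    {ψ : ℝ≥0 → B → B} (h_add : ∀ s t a, ψ (s + t) a = ψ s (ψ t a))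
    (hT : ∀ t a, (ψ t a : G →L[ℂ] G) = adjoint (ζ t : G →L[ℂ] (F t).H) ∘L (T t).op ∘L
      (E t).ρ a ∘L (ξ t : G →L[ℂ] (E t).H)) (s t r : ℝ≥0) (h : s + t = r) :
    (T r).op = adjoint (S'.β s t r h).op ∘L (T s).tensorOp (T t) ∘L (S.β s t r h).op := by
  refine Bimodule.IsCyclic.ext (hS.cyclic r) fun a g =>
    Bimodule.IsCyclic.ext_inner (hS'.cyclic r) fun a' g' => ?_
  -- On generators the right side becomes the pairing of `a' ζ_s ⊗ ζ_t g'` with `T_s a ξ_s ⊗ T_t ξ_t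
  -- g`. The first legs contribute `ψ_s (a'* a)`, and the second legs turn this into `ψ_t (ψ_s (a'*
  -- a))`.
  have h2 : (T s).tensorOp (T t) ((S.β s t r h).op ((E r).ρ a ((ξ r : G →L[ℂ] (E r).H) g))) =
      tmulOp (F s).toPreBimodule (F t).toPreBimodule
        ⟨_, (T s).map_mem _ ((E s).left_mem a _ (ξ s).2)⟩
        ((T t).op ((ξ t : G →L[ℂ] (E t).H) g)) := by
    rw [(S.β s t r h).op_ρ_apply (hS.unit s t r h), Hom.tensorOp_tmulOp]
  refine ((T r).inner_ρ_op_ρ _ _ _ _ _ _).trans ?_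
  refine Eq.trans ?_ (adjoint_inner_right (S'.β s t r h).op _ _).symm
  refine Eq.trans ?_ (congrArg₂ (fun v w => ⟪v, w⟫_ℂ)
    ((S'.β s t r h).op_ρ_apply (hS'.unit s t r h) a' g') h2).symm
  refine Eq.trans ?_ (inner_tmulOp _ _ _ _ _ _).symm
  have h1 : (F s).inn ⟨_, (F s).left_mem a' _ (ζ s).2⟩
      ⟨_, (T s).map_mem _ ((E s).left_mem a _ (ξ s).2)⟩ = ψ s (star a' * a) := by
    refine Subtype.ext (ContinuousLinearMap.ext fun k => ext_inner_left ℂ fun k' => ?_)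
    rw [hT, ← (T s).inner_ρ_op_ρ]
    exact adjoint_inner_right ((F s).ρ a' ∘L (ζ s : G →L[ℂ] (F s).H)) _ _
  have h4 : ⟪(ζ t : G →L[ℂ] (F t).H) g', (F t).ρ (ψ s (star a' * a))
      ((T t).op ((ξ t : G →L[ℂ] (E t).H) g))⟫_ℂ = ⟪g', (ψ r (star a' * a) : G →L[ℂ] G) g⟫_ℂ := by
    -- Left linearity of `T t` brings `ψ s (star a' * a)` next to `ξ t`, where it is an argument of
    -- `ψ t`.
    rw [← (T t).intertwines, ← h, add_comm, h_add, hT]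
    exact (adjoint_inner_right (ζ t : G →L[ℂ] (F t).H) _ _).symm
  rw [h1, h4, ← hT]

end Morphisms

/-! ### Matrix units, normality of the blocks, and cyclicity -/

section Blocks

variable {G : Type u} [NormedAddCommGroup G] [InnerProductSpace ℂ G] [CompleteSpace G]
  {B : VonNeumannAlgebra G}

open scoped ComplexOrder

lemma M2.coe_unit (i j : Fin 2) : (M2.unit B i j : Sq G →L[ℂ] Sq G) = inj G i ∘L prj G j := by
  refine ext_entry fun k l => ?_
  refine (congrArg Subtype.val (M2.ent_of (Matrix.single i j (1 : B)) k l)).trans ?_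
  ext g
  fin_cases i <;> fin_cases j <;> fin_cases k <;> fin_cases l <;>
    simp [Matrix.single, entry, inj_apply]

lemma unit_comp_dbl (i : Fin 2) : (M2.unit B i i : Sq G →L[ℂ] Sq G) ∘L dbl G = inj G i := by
  rw [M2.coe_unit, dbl, comp_assoc, comp_add, prj_comp_inj, prj_comp_inj]
  fin_cases i <;> simp

lemma M2.unit_add_unit : M2.unit B 0 0 + M2.unit B 1 1 = 1 :=
  Subtype.ext <| (congrArg₂ (· + ·) (M2.coe_unit 0 0) (M2.coe_unit 1 1)).trans sum_inj_comp_prj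

lemma norm_inj_comp_prj_le (i j : Fin 2) : ‖inj G i ∘L prj G j‖ ≤ 1 := by
  have hp : ∀ i, ‖prj G i‖ ≤ 1 := fun i =>
    ContinuousLinearMap.opNorm_le_bound _ zero_le_one fun v =>
      (PiLp.norm_apply_le v i).trans_eq (one_mul _).symm
  have hi : ‖inj G i‖ ≤ 1 := (LinearIsometryEquiv.norm_map adjoint (prj G i)).trans_le (hp i)
  exact (opNorm_comp_le (inj G i) (prj G j)).trans (mul_le_one₀ hi (norm_nonneg _) (hp j))

lemma M2.norm_unit_le (i j : Fin 2) : ‖M2.unit B i j‖ ≤ 1 := by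
  change ‖(M2.unit B i j : Sq G →L[ℂ] Sq G)‖ ≤ 1
  rw [M2.coe_unit]
  exact norm_inj_comp_prj_le i j

lemma scottContinuous_diag : ScottContinuous (M2.diag B) :=
  scottContinuous_of_inner_eq (n := Fin 2) (fun _ _ h => OrderHomClass.mono (M2.diag B) h)
    (fun i h => h i) fun x h => by
      rw [PiLp.inner_apply]
      refine Finset.sum_congr rfl fun i _ => ?_
      have h1 : ((M2.diag B x : Sq G →L[ℂ] Sq G) h) i = (x : G →L[ℂ] G) (h i) := by
        fin_cases i <;> simp [M2.diag, M2.of, inj_apply]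
      rw [h1]

/-- A vector functional of a diagonal entry at `g` is the vector functional of the whole matrix at
`inj G i g`. -/
lemma scottContinuous_ent (i : Fin 2) : ScottContinuous (M2.ent (B := B) i i) := by
  have h : ∀ (x : Sq G →L[ℂ] Sq G) (g : G),
      ⟪entry i i x g, g⟫_ℂ = ⟪x (inj G i g), inj G i g⟫_ℂ := fun x g =>
    (adjoint_inner_right (prj G i) (x (inj G i g)) g).symm
  refine scottContinuous_of_inner_eq (n := Unit) (fun X Y hXY => ?_) (fun _ g => inj G i g)
    fun x g => by rw [Fintype.sum_unique]; exact h x g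
  refine (ContinuousLinearMap.le_def _ _).mpr (isPositive_of_inner_nonneg fun g => ?_)
  have h1 := inner_sub_nonneg (show (X : Sq G →L[ℂ] Sq G) ≤ Y from hXY) (inj G i g)
  rw [sub_apply, inner_sub_left] at h1 ⊢
  change 0 ≤ ⟪entry i i Y g, g⟫_ℂ - ⟪entry i i X g, g⟫_ℂ
  rwa [h, h]

variable {K : Type u} [NormedAddCommGroup K] [InnerProductSpace ℂ K] [CompleteSpace K]
  {A : VonNeumannAlgebra K}

lemma PreBimodule.cyclicSub_le (F : PreBimodule A B) {ξ : G →L[ℂ] F.H} (hξ : ξ ∈ F.mod) :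
    (F.cyclicSub hξ).mod ≤ F.mod := fun x hx => by
  refine F.sotClosed (sotClosure_mono ?_ hx)
  rw [Submodule.span_le]
  rintro _ ⟨a, b, rfl⟩
  exact F.left_mem a _ (F.right_mem ξ hξ b)

/-- The orthogonal projection onto `carrierSpan` is a left inverse of the inclusion. It carries
strong approximations in the large space to strong approximations in the small one. -/
lemma PreBimodule.isCyclic_essential (F : PreBimodule A B) {ξ : G →L[ℂ] F.H} (hξ : ξ ∈ F.mod)
    (h : F.mod ≤ sotClosure (Submodule.span ℂ
      {y | ∃ (a : A) (b : B), y = F.ρ a ∘L ξ ∘L (b : G →L[ℂ] G)})) :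
    F.essential.IsCyclic (F.essentialVec hξ : G →L[ℂ] F.essential.H) := by
  intro x hx
  have hP : ∀ y : G →L[ℂ] F.carrierSpan,
      F.carrierSpan.orthogonalProjectionOnto ∘L (F.carrierSpan.subtypeL ∘L y) = y := fun y => by
    ext g
    simp
  have hle : ∀ y ∈ Submodule.span ℂ {y | ∃ (a : A) (b : B), y = F.ρ a ∘L ξ ∘L (b : G →L[ℂ] G)},
      F.carrierSpan.orthogonalProjectionOnto ∘L y ∘L ContinuousLinearMap.id ℂ G ∈
        Submodule.span ℂ {y | ∃ (a : A) (b : B), y = F.essential.ρ a ∘L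
          (F.essentialVec hξ : G →L[ℂ] F.essential.H) ∘L (b : G →L[ℂ] G)} := by
    intro y hy
    induction hy using Submodule.span_induction with
    | mem y hy =>
      obtain ⟨a, b, rfl⟩ := hy
      exact Submodule.subset_span ⟨a, b, hP (F.restrictOp a ∘L
        ξ.codRestrict F.carrierSpan (F.apply_mem_carrierSpan hξ) ∘L (b : G →L[ℂ] G))⟩
    | zero =>
      rw [zero_comp, comp_zero]
      exact zero_mem _
    | add y z _ _ hy hz =>
      rw [add_comp, comp_add]
      exact add_mem hy hz
    | smul c y _ hy =>
      rw [smul_comp, comp_smul]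
      exact Submodule.smul_mem _ c hy
  have h1 := sotClosure_map F.carrierSpan.orthogonalProjectionOnto (ContinuousLinearMap.id ℂ G) hle
    (h (show F.carrierSpan.subtypeL ∘L x ∈ F.mod from hx))
  rw [comp_id, hP x] at h1
  exact h1

end Blocks

/-! ### The corners of a GNS-vector of block form -/

section Corners

variable {G : Type u} [NormedAddCommGroup G] [InnerProductSpace ℂ G] [CompleteSpace G]
  {B : VonNeumannAlgebra G} (E : Bimodule (M2 B) (M2 B)) (η : E.mod)

lemma entry_adjoint_comp (i j : Fin 2) (X : M2 B) :
    adjoint ((η : Sq G →L[ℂ] E.H) ∘L inj G i) ∘L E.ρ X ∘L ((η : Sq G →L[ℂ] E.H) ∘L inj G j) =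
      entry i j (adjoint (η : Sq G →L[ℂ] E.H) ∘L E.ρ X ∘L (η : Sq G →L[ℂ] E.H)) := by
  rw [adjoint_comp, inj, adjoint_adjoint]
  rfl

variable {E η}

/-- If the corner `𝔼ᵢᵢ ⟨η, 𝔼ⱼⱼ η⟩ 𝔼ᵢᵢ` vanishes, then so does `𝔼ⱼⱼ η 𝔼ᵢᵢ`. -/
lemma ρ_unit_comp_inj_eq_zero {i j : Fin 2}
    (h : entry i i (adjoint (η : Sq G →L[ℂ] E.H) ∘L E.ρ (M2.unit B j j) ∘L
      (η : Sq G →L[ℂ] E.H)) = 0) :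
    E.ρ (M2.unit B j j) ∘L (η : Sq G →L[ℂ] E.H) ∘L inj G i = 0 := by
  have hs : star (M2.unit B j j) * M2.unit B j j = M2.unit B j j := by
    have h1 : star (M2.unit B j j) = M2.unit B j j := M2.ext_ent fun k l => by
      rw [M2.ent_star, M2.unit, M2.ent_of, M2.ent_of]
      fin_cases j <;> fin_cases k <;> fin_cases l <;> simp [Matrix.single]
    rw [h1, M2.unit_mul_self]
  ext g
  rw [zero_apply, ← inner_self_eq_zero (𝕜 := ℂ)]
  have h1 := E.inner_ρ_ρ ((η : Sq G →L[ℂ] E.H) ∘L inj G i) ((η : Sq G →L[ℂ] E.H) ∘L inj G i)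
    (M2.unit B j j) (M2.unit B j j) g g
  rw [hs, entry_adjoint_comp, h, zero_apply, inner_zero_right] at h1
  exact h1

variable (h : ∀ i j : Fin 2, j ≠ i → entry i i (adjoint (η : Sq G →L[ℂ] E.H) ∘L
  E.ρ (M2.unit B j j) ∘L (η : Sq G →L[ℂ] E.H)) = 0)
include h

lemma ρ_unit_comp_inj (i : Fin 2) :
    E.ρ (M2.unit B i i) ∘L (η : Sq G →L[ℂ] E.H) ∘L inj G i = (η : Sq G →L[ℂ] E.H) ∘L inj G i := by
  have h1 := congrArg (fun X : M2 B => E.ρ X ∘L (η : Sq G →L[ℂ] E.H) ∘L inj G i)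
    (M2.unit_add_unit (B := B))
  simp only [map_add, map_one, add_comp] at h1
  have h2 := fun j hj => ρ_unit_comp_inj_eq_zero (h i j hj)
  fin_cases i
  · rw [h2 1 (by decide), add_zero] at h1
    exact h1
  · rw [h2 0 (by decide), zero_add] at h1
    exact h1

/-- Split `η` into its two columns: `𝔼ᵢᵢ` fixes column `i` and kills the other one. So `η` commutes
with the diagonal matrix units, and `𝔼ᵢᵢ η 𝔼ᵢᵢ` is just `𝔼ᵢᵢ η`. -/
lemma ρ_unit_comp (i : Fin 2) : E.ρ (M2.unit B i i) ∘L (η : Sq G →L[ℂ] E.H) =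
    (η : Sq G →L[ℂ] E.H) ∘L (M2.unit B i i : Sq G →L[ℂ] Sq G) := by
  have h1 := congrArg (fun X => E.ρ (M2.unit B i i) ∘L (η : Sq G →L[ℂ] E.H) ∘L X)
    (sum_inj_comp_prj (G := G))
  simp only [comp_add, comp_id] at h1
  have h2 := fun j (hj : i ≠ j) => ρ_unit_comp_inj_eq_zero (h j i hj)
  have h3 := ρ_unit_comp_inj h i
  rw [← h1, M2.coe_unit]
  simp only [← comp_assoc] at h2 h3 ⊢
  fin_cases i
  · rw [h2 1 (by decide), zero_comp, add_zero]
    exact congrArg (· ∘L prj G 0) h3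
  · rw [h2 0 (by decide), zero_comp, zero_add]
    exact congrArg (· ∘L prj G 1) h3

lemma coe_cornerVec (i : Fin 2) :
    (cornerVec E i η : Sq G →L[ℂ] E.H) = E.ρ (M2.unit B i i) ∘L (η : Sq G →L[ℂ] E.H) := by
  change E.ρ (M2.unit B i i) ∘L (η : Sq G →L[ℂ] E.H) ∘L (M2.unit B i i : Sq G →L[ℂ] Sq G) = _
  rw [← ρ_unit_comp h, ← comp_assoc]
  exact congrArg (· ∘L (η : Sq G →L[ℂ] E.H))
    ((map_mul E.ρ _ _).symm.trans (congrArg E.ρ (M2.unit_mul_self i)))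

/-- The abstract quotient class becomes concrete: since `𝔼ᵢᵢ (g, g)` is `g` in slot `i`, the class
is the `i`-th column of `η`. -/
lemma coe_cornerClass (i : Fin 2) :
    (cornerClass E i η : G →L[ℂ] (cornerModule E i).H) = (η : Sq G →L[ℂ] E.H) ∘L inj G i := by
  change (cornerVec E i η : Sq G →L[ℂ] E.H) ∘L dbl G = _
  rw [coe_cornerVec h, ρ_unit_comp h, comp_assoc, unit_comp_dbl]

end Corners

/-! ### The diagonal modules and the compressed matrix units -/

section DiagonalModules

variable {G : Type u} [NormedAddCommGroup G] [InnerProductSpace ℂ G] [CompleteSpace G]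
  {B : VonNeumannAlgebra G} (E : Bimodule (M2 B) (M2 B)) (i : Fin 2) (η : E.mod)

/-- The inclusion of the Hilbert space of `diagModule E i η` into that of `E`. -/
def diagIncl : (diagModule E i η).H →L[ℂ] E.H :=
  ((cornerModule E i).cyclicSub (cornerClass E i η).2).carrierSpan.subtypeL

lemma inner_diagIncl (v w : (diagModule E i η).H) :
    ⟪diagIncl E i η v, diagIncl E i η w⟫_ℂ = ⟪v, w⟫_ℂ := rfl

lemma norm_diagIncl_le : ‖diagIncl E i η‖ ≤ 1 :=
  Submodule.norm_subtypeL_le _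

lemma diagIncl_ρ (a : B) (v : (diagModule E i η).H) :
    diagIncl E i η ((diagModule E i η).ρ a v) = E.ρ (M2.diag B a) (diagIncl E i η v) := rfl

/-- The subspace is invariant under the self-adjoint family of operators `ρ(diag(a, a))`, hence
reducing, so compression to it respects the left action. -/
lemma adjoint_diagIncl_ρ (a : B) (v : E.H) :
    adjoint (diagIncl E i η) (E.ρ (M2.diag B a) v) =
      (diagModule E i η).ρ a (adjoint (diagIncl E i η) v) := by
  refine ext_inner_left ℂ fun w => ?_
  rw [adjoint_inner_right, ← adjoint_inner_left (E.ρ _), ← star_eq_adjoint, ← map_star, ← map_star,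
    ← diagIncl_ρ, ← adjoint_inner_right, map_star, star_eq_adjoint, adjoint_inner_left]

lemma exists_diagIncl_comp {x : G →L[ℂ] (diagModule E i η).H} (hx : x ∈ (diagModule E i η).mod) :
    ∃ y ∈ E.mod, diagIncl E i η ∘L x = y ∘L dbl G := by
  obtain ⟨_, ⟨y, hy, rfl⟩, h⟩ := (cornerModule E i).cyclicSub_le (cornerClass E i η).2
    (show diagIncl E i η ∘L x ∈ _ from hx)
  exact ⟨_, E.left_mem _ y hy, h⟩

lemma isCyclic_diagVec :
    (diagModule E i η).IsCyclic (diagVec E i η : G →L[ℂ] (diagModule E i η).H) :=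
  ((cornerModule E i).cyclicSub (cornerClass E i η).2).isCyclic_essential
    ((cornerModule E i).mem_cyclicSub (cornerClass E i η).2) fun _ hx => hx

/-- The compression of `𝔼ᵢⱼ` to a bilinear map between the diagonal modules. -/
def diagHom (j : Fin 2) : Hom (diagModule E j η) (diagModule E i η) :=
  Hom.mk' (adjoint (diagIncl E i η) ∘L E.ρ (M2.unit B i j) ∘L diagIncl E j η)
    -- It is not evident that the compressed vector lies in the strong closure of `B ξ^i B`. By
    -- self-duality its inner products with `z` are enough, and these are sums of entries of an
    -- `M₂(B)`-valued inner product in `E`.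
    (fun x hx => (diagModule E i η).mem_of_inner_mem fun z hz => by
      obtain ⟨x', hx', hx⟩ := exists_diagIncl_comp E j η hx
      obtain ⟨z', hz', hz⟩ := exists_diagIncl_comp E i η hz
      have h1 : adjoint z ∘L (adjoint (diagIncl E i η) ∘L E.ρ (M2.unit B i j) ∘L
          diagIncl E j η) ∘L x =
          adjoint (z' ∘L dbl G) ∘L ((E.ρ (M2.unit B i j) ∘L x') ∘L dbl G) := by
        rw [← hz, comp_assoc (E.ρ _), ← hx, adjoint_comp]
        rfl
      rw [h1, dbl_inner]
      exact sum_mem fun k _ => sum_mem fun l _ =>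
        E.inner_mem _ hz' _ (E.left_mem _ _ hx') k l)
    fun a v => by
      simp only [comp_apply]
      rw [diagIncl_ρ, ← adjoint_diagIncl_ρ, ← mul_apply_eq_comp, ← mul_apply_eq_comp, ← map_mul,
        ← map_mul, M2.diag_mul_unit]

lemma norm_diagHom_le (j : Fin 2) : ‖(diagHom E i η j).op‖ ≤ 1 := by
  have h1 : ‖E.ρ (M2.unit B i j)‖ ≤ 1 :=
    (NonUnitalStarAlgHom.norm_apply_le E.ρ _).trans (M2.norm_unit_le i j)
  have h2 : ‖adjoint (diagIncl E i η)‖ ≤ 1 :=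
    (LinearIsometryEquiv.norm_map adjoint _).trans_le (norm_diagIncl_le E i η)
  refine (opNorm_comp_le _ _).trans (mul_le_one₀ h2 (norm_nonneg _) ?_)
  exact (opNorm_comp_le _ _).trans (mul_le_one₀ h1 (norm_nonneg _) (norm_diagIncl_le E j η))

variable {E η}
variable (h : ∀ i j : Fin 2, j ≠ i → entry i i (adjoint (η : Sq G →L[ℂ] E.H) ∘L
  E.ρ (M2.unit B j j) ∘L (η : Sq G →L[ℂ] E.H)) = 0)
include h

lemma diagIncl_comp_diagVec :
    diagIncl E i η ∘L (diagVec E i η : G →L[ℂ] (diagModule E i η).H) =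
      (η : Sq G →L[ℂ] E.H) ∘L inj G i :=
  coe_cornerClass h i

lemma diagVec_gns (a : B) :
    adjoint (diagVec E i η : G →L[ℂ] (diagModule E i η).H) ∘L (diagModule E i η).ρ a ∘L
      (diagVec E i η : G →L[ℂ] (diagModule E i η).H) =
    entry i i (adjoint (η : Sq G →L[ℂ] E.H) ∘L E.ρ (M2.diag B a) ∘L (η : Sq G →L[ℂ] E.H)) := by
  rw [← entry_adjoint_comp, ← diagIncl_comp_diagVec i h]
  ext g
  refine ext_inner_left ℂ fun k => ?_
  simp only [comp_apply, adjoint_inner_right]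
  rw [← diagIncl_ρ, inner_diagIncl]

/-- The inclusions cancel against the compression, leaving columns `i` and `j` of `η` around `𝔼ᵢⱼ
diag(a, a)`. For `i = 0`, `j = 1` and `η` a GNS-vector of `Φ`, this is `ψ`. -/
lemma diagVec_diagHom (j : Fin 2) (a : B) :
    adjoint (diagVec E i η : G →L[ℂ] (diagModule E i η).H) ∘L (diagHom E i η j).op ∘L
      (diagModule E j η).ρ a ∘L (diagVec E j η : G →L[ℂ] (diagModule E j η).H) =
    entry i j (adjoint (η : Sq G →L[ℂ] E.H) ∘L E.ρ (M2.unit B i j * M2.diag B a) ∘L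
      (η : Sq G →L[ℂ] E.H)) := by
  rw [← entry_adjoint_comp, ← diagIncl_comp_diagVec i h, ← diagIncl_comp_diagVec j h, adjoint_comp,
    map_mul]
  rfl

end DiagonalModules

/-! ### Corners of units, and entries of block matrices -/

section Corners

variable {G : Type u} [NormedAddCommGroup G] [InnerProductSpace ℂ G] [CompleteSpace G]
  {B : VonNeumannAlgebra G}

/-- The corners of a unit of an inclusion system form a unit. -/
lemma op_comp_cornerVec {E F F' : Bimodule (M2 B) (M2 B)} {η : E.mod} {ζ : F.mod} {ζ' : F'.mod}
    (hη : ∀ i j : Fin 2, j ≠ i → entry i i (adjoint (η : Sq G →L[ℂ] E.H) ∘L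
      E.ρ (M2.unit B j j) ∘L (η : Sq G →L[ℂ] E.H)) = 0)
    (hζ : ∀ i j : Fin 2, j ≠ i → entry i i (adjoint (ζ : Sq G →L[ℂ] F.H) ∘L
      F.ρ (M2.unit B j j) ∘L (ζ : Sq G →L[ℂ] F.H)) = 0)
    (hζ' : ∀ i j : Fin 2, j ≠ i → entry i i (adjoint (ζ' : Sq G →L[ℂ] F'.H) ∘L
      F'.ρ (M2.unit B j j) ∘L (ζ' : Sq G →L[ℂ] F'.H)) = 0)
    (T : Hom E (F.tensor F'))
    (hT : T.op ∘L (η : Sq G →L[ℂ] E.H) = (F.tmul F' ζ ζ' : Sq G →L[ℂ] (F.tensor F').H))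
    (i : Fin 2) : T.op ∘L (cornerVec E i η : Sq G →L[ℂ] E.H) =
      (F.tmul F' (cornerVec F i ζ) (cornerVec F' i ζ') : Sq G →L[ℂ] (F.tensor F').H) := by
  rw [coe_cornerVec hη]
  refine T.op_comp_ρ_comp hT _ (coe_cornerVec hζ i) ?_ (coe_cornerVec hζ' i)
  rw [coe_cornerVec hζ, comp_assoc]
  exact (coe_cornerVec hζ i).symm

lemma M2.ent_zero (i j : Fin 2) : M2.ent i j (0 : M2 B) = 0 := by
  simpa using M2.ent_smul i j 0 (0 : M2 B)

lemma M2.of_ent (X : M2 B) :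
    M2.of !![M2.ent 0 0 X, M2.ent 0 1 X; M2.ent 1 0 X, M2.ent 1 1 X] = X :=
  M2.ext_ent fun i j => by
    rw [M2.ent_of]
    fin_cases i <;> fin_cases j <;> rfl

lemma M2.ent_diag (i : Fin 2) (a : B) : M2.ent i i (M2.diag B a) = a :=
  (M2.ent_of _ i i).trans (Matrix.diagonal_apply_eq _ _)

lemma M2.ent_unit_self {i j : Fin 2} (h : j ≠ i) : M2.ent i i (M2.unit B j j) = 0 := by
  rw [M2.unit, M2.ent_of, Matrix.single_apply_of_row_ne h]

lemma M2.ent_unit_mul_diag (i j : Fin 2) (a : B) :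
    M2.ent i j (M2.unit B i j * M2.diag B a) = a := by
  rw [M2.ent_mul, M2.unit, M2.ent_of, M2.ent_of]
  change _ * M2.ent _ _ (M2.of _) + _ * M2.ent _ _ (M2.of _) = a
  rw [M2.ent_of, M2.ent_of]
  fin_cases i <;> fin_cases j <;> simp [Matrix.single]

end Corners

end VNMod

end

/-! ### The theorem -/

open VNMod
theorem theorem4p4 {G : Type u} [NormedAddCommGroup G] [InnerProductSpace ℂ G] [CompleteSpace G]
    (B : VonNeumannAlgebra G)
    (Φ : ℝ≥0 → CompletelyPositiveMap (M2 B) (M2 B))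
    (φ : Fin 2 → ℝ≥0 → B → B) (ψ : ℝ≥0 → B → B)
    (h_normal : ∀ t, ScottContinuous (Φ t))
    (h_zero : ∀ X, Φ 0 X = X)
    (h_add : ∀ s t X, Φ (s + t) X = Φ s (Φ t X))
    (h_block : ∀ t a b c d, Φ t (M2.of !![a, b; c, d]) =
      M2.of !![φ 0 t a, ψ t b; star (ψ t (star c)), φ 1 t d]) :
    (∃ (E : ℝ≥0 → Bimodule (M2 B) (M2 B)) (S : InclusionSystem E) (η : ∀ t, (E t).mod),
      IsAssociated S η fun t => Φ t) ∧
    ∀ (E : ℝ≥0 → Bimodule (M2 B) (M2 B)) (S : InclusionSystem E) (η : ∀ t, (E t).mod),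
      IsAssociated S η (fun t => Φ t) →
      (∀ i s t r h, (S.β s t r h).op ∘L (cornerVec (E r) i (η r) : Sq G →L[ℂ] (E r).H) =
        ((E s).tmul (E t) (cornerVec (E s) i (η s)) (cornerVec (E t) i (η t)) :
          Sq G →L[ℂ] ((E s).tensor (E t)).H)) ∧
      ∃ D : ∀ i, InclusionSystem fun t => diagModule (E t) i (η t),
        (∀ i, IsAssociated (D i) (fun t => diagVec (E t) i (η t)) (φ i)) ∧
        ∃! T : ∀ t, Hom (diagModule (E t) 1 (η t)) (diagModule (E t) 0 (η t)),
          IsWeakMorphism (D 1) (D 0) T ∧ (∀ t, ‖(T t).op‖ ≤ 1) ∧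
          ∀ t a, (ψ t a : G →L[ℂ] G) =
            adjoint (diagVec (E t) 0 (η t) : G →L[ℂ] (diagModule (E t) 0 (η t)).H) ∘L (T t).op ∘L
              (diagModule (E t) 1 (η t)).ρ a ∘L
              (diagVec (E t) 1 (η t) : G →L[ℂ] (diagModule (E t) 1 (η t)).H) := by
  -- The block form says that each entry of `Φ t X` depends only on the same entry of `X`; normality
  -- and the semigroup laws descend to the blocks this way.
  have h_ent : ∀ i t X, M2.ent i i (Φ t X) = φ i t (M2.ent i i X) := by
    intro i t X
    conv_lhs => rw [← M2.of_ent X, h_block, M2.ent_of]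
    fin_cases i <;> rfl
  have h_off : ∀ t X, M2.ent 0 1 (Φ t X) = ψ t (M2.ent 0 1 X) := by
    intro t X
    conv_lhs => rw [← M2.of_ent X, h_block, M2.ent_of]
    rfl
  have hφ : ∀ i t a, φ i t a = M2.ent i i (Φ t (M2.diag B a)) := fun i t a => by
    rw [h_ent, M2.ent_diag]
  have hφ_normal : ∀ i t, ScottContinuous (φ i t) := fun i t => by
    rw [funext (hφ i t)]
    exact (scottContinuous_diag.comp (h_normal t)).comp (scottContinuous_ent i)
  have hφ_zero : ∀ i a, φ i 0 a = a := fun i a => by rw [hφ, h_zero, M2.ent_diag]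
  have hφ_add : ∀ i s t a, φ i (s + t) a = φ i s (φ i t a) := fun i s t a => by
    rw [hφ, h_add, h_ent, ← hφ]
  have hψ : ∀ t a, ψ t a = M2.ent 0 1 (Φ t (M2.unit B 0 1 * M2.diag B a)) := fun t a => by
    rw [h_off, M2.ent_unit_mul_diag]
  have hψ_add : ∀ s t a, ψ (s + t) a = ψ s (ψ t a) := fun s t a => by
    rw [hψ, h_add, h_off, ← hψ]
  constructor
  · choose E η hgns hcyc using fun t => exists_gns (Φ t)
    obtain ⟨S, hS⟩ := exists_inclusionSystem η h_normal h_zero h_add hgns hcyc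
    exact ⟨E, S, η, hS⟩
  · intro E S η hS
    -- The `(i, i)` entry of `Φ t 𝔼ⱼⱼ` is `φ i t 0 = 0`. Through this the block form controls the
    -- vector `η`.
    have hη : ∀ t i j, j ≠ i → entry i i (adjoint (η t : Sq G →L[ℂ] (E t).H) ∘L
        (E t).ρ (M2.unit B j j) ∘L (η t : Sq G →L[ℂ] (E t).H)) = 0 := by
      intro t i j hij
      rw [hS.gns]
      have h1 : M2.ent i i (Φ t (M2.unit B j j)) = 0 := by
        rw [h_ent, M2.ent_unit_self hij, hφ, map_zero, map_zero, M2.ent_zero]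
      exact congrArg Subtype.val h1
    refine ⟨fun i s t r h => op_comp_cornerVec (hη r) (hη s) (hη t) _ (hS.unit s t r h) i, ?_⟩
    have hgns : ∀ i t a, adjoint (diagVec (E t) i (η t) : G →L[ℂ] (diagModule (E t) i (η t)).H) ∘L
        (diagModule (E t) i (η t)).ρ a ∘L
        (diagVec (E t) i (η t) : G →L[ℂ] (diagModule (E t) i (η t)).H) = (φ i t a : G →L[ℂ] G) :=
      fun i t a => by
        rw [diagVec_gns i (hη t), hS.gns, hφ]
        rfl
    choose D hD using fun i => exists_inclusionSystem (fun t => diagVec (E t) i (η t))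
      (hφ_normal i) (hφ_zero i) (hφ_add i) (hgns i) fun t => isCyclic_diagVec (E t) i (η t)
    have hT : ∀ t a, (ψ t a : G →L[ℂ] G) =
        adjoint (diagVec (E t) 0 (η t) : G →L[ℂ] (diagModule (E t) 0 (η t)).H) ∘L
          (diagHom (E t) 0 (η t) 1).op ∘L (diagModule (E t) 1 (η t)).ρ a ∘L
            (diagVec (E t) 1 (η t) : G →L[ℂ] (diagModule (E t) 1 (η t)).H) := fun t a => by
      rw [diagVec_diagHom 0 (hη t), hS.gns, hψ]
      rfl
    have hnorm : ∀ t, ‖(diagHom (E t) 0 (η t) 1).op‖ ≤ 1 := fun t => norm_diagHom_le _ _ _ _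
    -- Contractivity allows the growth exponent `k = 0`.
    refine ⟨D, hD, fun t => diagHom (E t) 0 (η t) 1, ⟨⟨⟨0, fun t => ?_⟩, fun s t r h => ?_⟩,
      hnorm, hT⟩, ?_⟩
    · rw [mul_zero, Real.exp_zero]
      exact hnorm t
    · exact op_eq_of_semigroup (hD 1) (hD 0) _ hψ_add hT s t r h
    · rintro T' ⟨-, -, hT'⟩
      funext t
      exact Hom.ext_of_cyclic ((hD 1).cyclic t) ((hD 0).cyclic t) fun a => by rw [← hT', ← hT]
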